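/- Let $d\ge 1$. A (generalized) measurement on a $d$-level quantum system is a family of positive semidefinite operators $\Pi_\xi$ on $\mathbb C^d$, indexed by a measure space of outcomes, with $\int\Pi_\xi\,\mathrm d\xi=1$ (a sum $\sum_\xi\Pi_\xi=1$ in the discrete case). It is performed on each copy of the system, whatever the earlier outcomes (nonadaptive). For a state $\rho$ the outcome probabilities are $p_\xi=\operatorname{tr}(\Pi_\xi\rho)$; the measurement is informationally complete (IC) if the probabilities $p_\xi$ (for almost every $\xi$) determine the state. The covariant measurement has as outcomes all pure states $|\psi\rangle\langle\psi|$, with outcome operators $d\,|\psi\rangle\langle\psi|\,\mathrm d\mu(\psi)$, where $\mu$ is the normalized Haar (unitarily invariant) measure on pure states. Write $|A\rangle\!\rangle$ for an operator $A$ regarded as a vector in the Hilbert-Schmidt space, $\langle\!\langle A|B\rangle\!\rangle=\operatorname{tr}(A^\dagger B)$, and $\operatorname{Tr}$ for the trace of superoperators. For a full-rank state $\rho$ and an IC measurement let $$\mathcal F(\rho)=\int |\Pi_\xi\rangle\!\rangle\frac1{p_\xi}\langle\!\langle\Pi_\xi|\,\mathrm d\xi,\qquad |\Theta_\xi\rangle\!\rangle=p_\xi^{-1}\mathcal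 F(\rho)^{-1}|\Pi_\xi\rangle\!\rangle,\qquad \mathcal C(\rho)=\int|\Theta_\xi\rangle\!\rangle p_\xi\langle\!\langle\Theta_\xi|\,\mathrm d\xi-|\rho\rangle\!\rangle\langle\!\langle\rho|$$ be the frame superoperator, the optimal reconstruction operators, and the scaled mean-square error matrix of the corresponding estimator. For a distance $D$ on states whose square has, at every full-rank state $\rho$, the expansion $D(\rho,\sigma)^2=\langle\!\langle\sigma-\rho|\mathcal W(\rho)|\sigma-\rho\rangle\!\rangle+o(\|\sigma-\rho\|_{\mathrm{HS}}^2)$ as $\sigma\to\rho$ in the set of states, with a positive semidefinite weighting matrix $\mathcal W(\rho)$, the scaled weighted mean-square error (WMSE) based on $D$ is $\mathcal E_{\mathcal W}(\rho)=\operatorname{Tr}\{\mathcal W(\rho)\,\mathcal C(\rho)\}$. The volume of the scaled uncertainty ellipsoid is $$\mathcal V(\rho)=\frac{\pi^{(d^2-1)/2}}{\Gamma\bigl(\frac{d^2+1}2\bigr)}\sqrt{\bar{\operatorname{Det}}\,\mathcal C(\rho)},$$ where $\bar{\operatorname{Det}}$ is the determinant of the restriction to the space of traceless Hermitian operators. The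 average of a figure of merit $f$ over the states unitarily equivalent to $\rho$ is $\overline{f(\rho)}=\int f(V\rho V^\dagger)\,\mathrm dV$, with respect to the normalized Haar measure on $U(d)$. **Theorem.** The covariant measurement is IC. For every full-rank state $\rho$ and every IC measurement, the following averages exist for both measurements, and their values for the covariant measurement are at most those for the given measurement: 1. the average WMSE $\overline{\mathcal E_{\mathcal W}(\rho)}$ based on any unitarily invariant distance $D$ (that is, $D(V\rho V^\dagger,V\sigma V^\dagger)=D(\rho,\sigma)$ for all unitary $V$) with weighting matrix $\mathcal W$ as above; 2. in particular, the average mean-square error (MSE): the Hilbert-Schmidt distance is unitarily invariant and has the weighting matrix $\mathcal W=\mathbf I$; 3. in particular, the average mean-square Bures distance (MSB): the Bures distance $D_{\mathrm B}(\rho,\sigma)^2=2-2\operatorname{tr}\sqrt{\sqrt\rho\,\sigma\sqrt\rho}$ is unitarily invariant and its weighting matrix $\mathcal W_{\mathrm B}(\rho)$ is half the inverse of the superoperator $X\mapsto\rho X+X\rho$, that is, $\langle\!\langle X|\mathcal W_{\mathrm B}(\rho)|X\rangle\!\rangle=\frac12\sum_{j,k}\frac{|\langle j|X|k\rangle|^2}{\lambda_j+\lambda_k}$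 for Hermitian $X$, in an eigenbasis $|j\rangle$ of $\rho$ with eigenvalues $\lambda_j$; 4. the average log-volume $\overline{\ln\mathcal V(\rho)}$ of the scaled uncertainty ellipsoid. -/

import Mathlib

open Matrix MeasureTheory Topology
open scoped Kronecker ComplexOrder

noncomputable section

namespace QTomo

/-- Operators on the `d`-dimensional Hilbert space. -/
abbrev Op (d : ℕ) := Matrix (Fin d) (Fin d) ℂ

/-- Superoperators, written as matrices that act on the operator kets `|A⟩⟩ = A.vec`. -/
abbrev SuperOp (d : ℕ) := Matrix (Fin d × Fin d) (Fin d × Fin d) ℂ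

/-- The unitary group `U(d)`. -/
abbrev U (d : ℕ) := Matrix.unitaryGroup (Fin d) ℂ

/-- The superoperator `|A⟩⟩⟨⟨B|`. -/
def ketBra {d : ℕ} (A B : Op d) : SuperOp d := vecMulVec A.vec (star B.vec)

/-- The number `⟨⟨X|O|X⟩⟩` (its real part, which is all of it for Hermitian `O`). -/
def quadForm {d : ℕ} (O : SuperOp d) (X : Op d) : ℝ := (star X.vec ⬝ᵥ (O *ᵥ X.vec)).re

/-- The unitarily transformed operator `V A V†`. -/
def conj {d : ℕ} (V : U d) (A : Op d) : Op d := (V : Op d) * A * (V : Op d)ᴴ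

/-! ### Quantum states -/

/-- Density operators. -/
def IsState {d : ℕ} (ρ : Op d) : Prop := ρ.PosSemidef ∧ ρ.trace = 1

/-- Density operators of full rank. -/
def IsFullRankState {d : ℕ} (ρ : Op d) : Prop := ρ.PosDef ∧ ρ.trace = 1

/-! ### Measurements and their statistics -/

/-- A generalized measurement with outcomes `ξ ∈ Ω`: the operators `Π_ξ ≥ 0` together with a
reference measure `dξ`, with `∫ Π_ξ dξ = 1` (entrywise). For the counting measure on a finite or
countable `Ω` this is a family of positive operators that sum up to the identity. -/
structure Measurement (d : ℕ) (Ω : Type*) [MeasurableSpace Ω] where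
  ref : Measure Ω
  op : Ω → Op d
  posSemidef : ∀ ξ, (op ξ).PosSemidef
  integrable : ∀ i j, Integrable (fun ξ => op ξ i j) ref
  integral_eq : ∀ i j, ∫ ξ, op ξ i j ∂ref = (1 : Op d) i j

namespace Measurement

variable {d : ℕ} {Ω : Type*} [MeasurableSpace Ω] (M : Measurement d Ω)

/-- Born rule `p_ξ = tr(Π_ξ ρ)` (a density with respect to the reference measure). -/
def prob (ρ : Op d) (ξ : Ω) : ℝ := (M.op ξ * ρ).trace.re

/-- Informational completeness: every state is determined by the measurement statistics. -/
def IsIC : Prop :=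
  ∀ ρ σ : Op d, IsState ρ → IsState σ → (∀ᵐ ξ ∂M.ref, M.prob ρ ξ = M.prob σ ξ) → ρ = σ

/-- The frame superoperator `F(ρ) = ∫ |Π_ξ⟩⟩ (1 / p_ξ) ⟨⟨Π_ξ| dξ`. -/
def frame (ρ : Op d) : SuperOp d :=
  Matrix.of fun i j => ∫ ξ, ((M.prob ρ ξ)⁻¹ : ℂ) * ketBra (M.op ξ) (M.op ξ) i j ∂M.ref

/-- The optimal reconstruction operators `|Θ_ξ⟩⟩ = p_ξ⁻¹ F(ρ)⁻¹ |Π_ξ⟩⟩`. -/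
def optRec (ρ : Op d) (ξ : Ω) : Op d :=
  Matrix.of fun i j => ((M.prob ρ ξ)⁻¹ : ℂ) * ((M.frame ρ)⁻¹ *ᵥ (M.op ξ).vec) (j, i)

/-- The scaled MSE matrix `∫ |Θ_ξ⟩⟩ p_ξ ⟨⟨Θ_ξ| dξ - |ρ⟩⟩⟨⟨ρ|` of the linear estimator with
reconstruction operators `Θ_ξ`. -/
def mseMatrix (Θ : Ω → Op d) (ρ : Op d) : SuperOp d :=
  (Matrix.of fun i j => ∫ ξ, (M.prob ρ ξ : ℂ) * ketBra (Θ ξ) (Θ ξ) i j ∂M.ref) - ketBra ρ ρ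

/-- The scaled MSE matrix `C(ρ)` under the optimal reconstruction. -/
def optMSEMatrix (ρ : Op d) : SuperOp d := M.mseMatrix (M.optRec ρ) ρ

/-- The scaled weighted mean-square error `Tr{W(ρ) C(ρ)}` under the optimal reconstruction, for a
weighting matrix `W(ρ)`. -/
def wmse (W : Op d → SuperOp d) (ρ : Op d) : ℝ := (W ρ * M.optMSEMatrix ρ).trace.re

end Measurement

/-! ### Volume of the uncertainty ellipsoid -/

/-- The kets `|A⟩⟩` of the traceless operators `A`. This is the complexification of the space of
traceless Hermitian operators. -/
def tracelessKets (d : ℕ) : Submodule ℂ (Fin d × Fin d → ℂ) :=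
  LinearMap.ker (∑ i : Fin d, LinearMap.proj (R := ℂ) (φ := fun _ : Fin d × Fin d => ℂ) (i, i))

theorem mem_tracelessKets {d : ℕ} (v : Fin d × Fin d → ℂ) :
    v ∈ tracelessKets d ↔ ∑ i : Fin d, v (i, i) = 0 := by
  simp [tracelessKets]

/-- The orthogonal projection `A ↦ A - tr(A) / d` onto the traceless operators, on kets. -/
def tracelessProj (d : ℕ) : (Fin d × Fin d → ℂ) →ₗ[ℂ] tracelessKets d :=
  LinearMap.codRestrict (tracelessKets d)
    (LinearMap.id - ((d : ℂ)⁻¹ •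
      ((∑ i : Fin d, LinearMap.proj (R := ℂ) (φ := fun _ : Fin d × Fin d => ℂ) (i, i)).smulRight
        (1 : Op d).vec)))
    (by
      intro v
      rw [mem_tracelessKets]
      rcases Nat.eq_zero_or_pos d with h | h
      · subst h; simp
      · have : (d : ℂ) ≠ 0 := by exact_mod_cast h.ne'
        simp [Finset.sum_sub_distrib]
        field_simp
        simp)

/-- The determinant of the restriction of a superoperator to the space of traceless operators. -/
def barDet {d : ℕ} (O : SuperOp d) : ℂ :=
  LinearMap.det (tracelessProj d ∘ₗ O.mulVecLin ∘ₗ (tracelessKets d).subtype)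

/-- The volume of the unit ball of dimension `d² - 1`. -/
def unitBallVol (d : ℕ) : ℝ :=
  Real.pi ^ (((d : ℝ) ^ 2 - 1) / 2) / Real.Gamma (((d : ℝ) ^ 2 + 1) / 2)

/-- The volume of the scaled uncertainty ellipsoid under the optimal reconstruction. -/
def Measurement.volume {d : ℕ} {Ω : Type*} [MeasurableSpace Ω] (M : Measurement d Ω)
    (ρ : Op d) : ℝ :=
  unitBallVol d * Real.sqrt (barDet (M.optMSEMatrix ρ)).re

/-! ### Haar measure and averages over unitarily equivalent states -/

instance (d : ℕ) : MeasurableSpace (U d) := borel _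

instance (d : ℕ) : BorelSpace (U d) := ⟨rfl⟩

instance (d : ℕ) : CompactSpace (U d) := by
  suffices h : IsCompact ((U d : Submonoid (Op d)) : Set (Op d)) from
    isCompact_iff_compactSpace.mp h
  have hK : IsCompact (Set.pi Set.univ fun _ : Fin d =>
      Set.pi Set.univ fun _ : Fin d => Metric.closedBall (0 : ℂ) 1) :=
    isCompact_univ_pi fun _ => isCompact_univ_pi fun _ => isCompact_closedBall 0 1
  refine hK.of_isClosed_subset ?_ ?_
  · have : ((U d : Submonoid (Op d)) : Set (Op d)) =
        {A : Op d | A * star A = 1} := by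
      ext A
      exact Matrix.mem_unitaryGroup_iff
    rw [this]
    have hc : Continuous fun A : Op d => A * Aᴴ :=
      continuous_id.matrix_mul continuous_id.matrix_conjTranspose
    exact isClosed_eq hc continuous_const
  · intro A hA i _ j _
    simpa using entry_norm_bound_of_unitary hA i j

/-- The normalized Haar measure on the unitary group. -/
def haarU (d : ℕ) : Measure (U d) := Measure.haarMeasure ⊤

instance (d : ℕ) : (haarU d).IsHaarMeasure := by unfold haarU; infer_instance

instance (d : ℕ) : IsProbabilityMeasure (haarU d) :=
  ⟨by simpa [haarU] using Measure.haarMeasure_self (K₀ := (⊤ : TopologicalSpace.PositiveCompacts (U d)))⟩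

/-- The average of a figure of merit over the states `V ρ V†`, with `V` Haar distributed. -/
def orbitAverage {d : ℕ} (f : Op d → ℝ) (ρ : Op d) : ℝ := ∫ V : U d, f (conj V ρ) ∂haarU d

/-- Both figures of merit have an average over the states unitarily equivalent to `ρ`, and the
average of the first is at most that of the second. -/
def OrbitAverageLE {d : ℕ} (f g : Op d → ℝ) (ρ : Op d) : Prop :=
  Integrable (fun V : U d => f (conj V ρ)) (haarU d) ∧
  Integrable (fun V : U d => g (conj V ρ)) (haarU d) ∧
  orbitAverage f ρ ≤ orbitAverage g ρ

/-! ### The covariant measurement -/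

/-- Pure states, that is, rank-one orthogonal projectors `|ψ⟩⟨ψ|`. -/
def PureState (d : ℕ) : Type := {P : Op d // P.IsHermitian ∧ P * P = P ∧ P.trace = 1}

instance (d : ℕ) : TopologicalSpace (PureState d) := instTopologicalSpaceSubtype

instance (d : ℕ) : MeasurableSpace (PureState d) := borel _

instance (d : ℕ) : BorelSpace (PureState d) := ⟨rfl⟩

theorem star_mul_coe {d : ℕ} (V : U d) : (V : Op d)ᴴ * (V : Op d) = 1 :=
  Matrix.mem_unitaryGroup_iff'.mp V.2

/-- The pure state `V |0⟩⟨0| V†`. -/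
def pureOrbit (d : ℕ) [NeZero d] (V : U d) : PureState d :=
  ⟨conj V (Matrix.single 0 0 1), by
    refine ⟨?_, ?_, ?_⟩
    · exact isHermitian_mul_mul_conjTranspose _ (by simp [Matrix.IsHermitian])
    · have h := star_mul_coe V
      calc (V : Op d) * single 0 0 1 * (V : Op d)ᴴ * ((V : Op d) * single 0 0 1 * (V : Op d)ᴴ)
          = (V : Op d) * single 0 0 1 * ((V : Op d)ᴴ * (V : Op d)) * single 0 0 1 * (V : Op d)ᴴ := by
            simp only [Matrix.mul_assoc]
        _ = _ := by rw [h]; simp [Matrix.mul_assoc, conj]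
    · rw [conj, Matrix.trace_mul_comm, ← Matrix.mul_assoc, star_mul_coe]
      simp⟩

/-- The unitarily invariant ("Haar") probability measure on the pure states. -/
def haarPure (d : ℕ) [NeZero d] : Measure (PureState d) := (haarU d).map (pureOrbit d)

theorem continuous_conj {d : ℕ} (A : Op d) : Continuous fun V : U d => conj V A := by
  unfold conj
  have h : Continuous fun V : U d => (V : Op d) := continuous_subtype_val
  exact (h.matrix_mul continuous_const).matrix_mul h.matrix_conjTranspose

theorem continuous_pureOrbit (d : ℕ) [NeZero d] : Continuous (pureOrbit d) :=
  Continuous.subtype_mk (continuous_conj _) _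

theorem continuous_pure_entry {d : ℕ} (i j : Fin d) :
    Continuous fun P : PureState d => P.1 i j :=
  (continuous_subtype_val (p := fun P : Op d =>
    P.IsHermitian ∧ P * P = P ∧ P.trace = 1)).matrix_elem i j

theorem integrable_conj_entry {d : ℕ} (A : Op d) (i j : Fin d) :
    Integrable (fun V : U d => conj V A i j) (haarU d) :=
  ((continuous_conj A).matrix_elem i j).integrable_of_hasCompactSupport
    (HasCompactSupport.of_compactSpace _)

theorem conj_mul {d : ℕ} (V V' : U d) (A : Op d) : conj (V * V') A = conj V (conj V' A) := by
  simp [conj, Matrix.mul_assoc, Matrix.conjTranspose_mul]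

/-- Schur's lemma for the Haar average of an operator. -/
theorem integral_conj {d : ℕ} [NeZero d] (A : Op d) (hA : A.trace = 1) (i j : Fin d) :
    (d : ℂ) * ∫ V : U d, conj V A i j ∂haarU d = (1 : Op d) i j := by
  set B : Op d := Matrix.of fun i j => ∫ V : U d, conj V A i j ∂haarU d with hB
  have inv : ∀ V : U d, conj V B = B := by
    intro V
    ext k l
    have h1 : ∫ V' : U d, conj (V * V') A k l ∂haarU d = B k l :=
      integral_mul_left_eq_self (fun V' : U d => conj V' A k l) V
    rw [← h1]
    simp only [conj_mul]
    simp only [conj, Matrix.mul_apply, Finset.sum_mul]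
    rw [integral_finsetSum _ fun b _ => ?_]
    · refine Finset.sum_congr rfl fun b _ => ?_
      rw [integral_finsetSum _ fun c _ => ?_]
      · refine Finset.sum_congr rfl fun c _ => ?_
        rw [integral_mul_const, integral_const_mul, hB]
        simp [conj, Matrix.mul_apply, Finset.sum_mul]
      · have := ((integrable_conj_entry A c b).const_mul ((V : Op d) k c)).mul_const
          ((V : Op d)ᴴ b l)
        simpa [conj, Matrix.mul_apply, Finset.sum_mul] using this
    · refine integrable_finsetSum _ fun c _ => ?_
      have := ((integrable_conj_entry A c b).const_mul ((V : Op d) k c)).mul_const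
        ((V : Op d)ᴴ b l)
      simpa [conj, Matrix.mul_apply, Finset.sum_mul] using this
  have comm : ∀ V : U d, (V : Op d) * B = B * (V : Op d) := by
    intro V
    have h := congrArg (· * (V : Op d)) (inv V)
    simp only [conj, Matrix.mul_assoc] at h
    rw [star_mul_coe, Matrix.mul_one] at h
    exact h
  have off : ∀ k l, k ≠ l → B k l = 0 := by
    intro k l hkl
    let D : Op d := Matrix.diagonal fun m => if m = k then -1 else 1
    have hD : D ∈ U d := by
      rw [Matrix.mem_unitaryGroup_iff, Matrix.star_eq_conjTranspose]
      simp only [D, Matrix.diagonal_conjTranspose, Matrix.diagonal_mul_diagonal]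
      rw [← Matrix.diagonal_one]
      congr 1
      ext m
      by_cases h : m = k <;> simp [h]
    have h := congrFun (congrFun (comm ⟨D, hD⟩) k) l
    simp only [D, Matrix.diagonal_mul, Matrix.mul_diagonal] at h
    simp only [if_true, if_neg hkl.symm] at h
    have : (2 : ℂ) * B k l = 0 := by linear_combination -h
    simpa using this
  have diag : ∀ k l, B k k = B l l := by
    intro k l
    let P : Op d := (Equiv.swap k l).permMatrix ℂ
    have hP : P ∈ U d := by
      rw [Matrix.mem_unitaryGroup_iff, Matrix.star_eq_conjTranspose]
      simp only [P, Matrix.conjTranspose_permMatrix, ← Matrix.permMatrix_mul]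
      simp
    have h := congrFun (congrFun (comm ⟨P, hP⟩) k) l
    simp only [P] at h
    simpa [Equiv.Perm.permMatrix, PEquiv.toMatrix_toPEquiv_mul, PEquiv.mul_toMatrix_toPEquiv]
      using h.symm
  have tr : ∑ k, B k k = 1 := by
    simp only [hB, Matrix.of_apply]
    rw [← integral_finsetSum _ fun k _ => integrable_conj_entry A k k]
    have : ∀ V : U d, ∑ k, conj V A k k = 1 := by
      intro V
      change (conj V A).trace = 1
      rw [conj, Matrix.trace_mul_comm, ← Matrix.mul_assoc, star_mul_coe, Matrix.one_mul, hA]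
    simp [this]
  change (d : ℂ) * B i j = _
  by_cases hij : i = j
  · subst hij
    rw [Finset.sum_congr rfl fun k _ => diag k i] at tr
    simpa using tr
  · simp [off i j hij, hij]

theorem PureState.posSemidef {d : ℕ} (P : PureState d) : P.1.PosSemidef := by
  have h : P.1 = P.1ᴴ * P.1 := by rw [P.2.1.eq, P.2.2.1]
  rw [h]
  exact Matrix.posSemidef_conjTranspose_mul_self _

/-- The covariant measurement: the outcomes are all pure states, weighted by the Haar measure;
the outcome operators are `d |ψ⟩⟨ψ| dμ(ψ)`. -/
def covariant (d : ℕ) [NeZero d] : Measurement d (PureState d) where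
  ref := haarPure d
  op P := (d : ℂ) • P.1
  posSemidef P := P.posSemidef.smul (by positivity)
  integrable i j := by
    have hm := (continuous_pureOrbit d).measurable.aemeasurable (μ := haarU d)
    refine (integrable_map_measure ?_ hm).mpr ?_
    · exact ((continuous_const (y := (d : ℂ))).mul
        (continuous_pure_entry i j)).aestronglyMeasurable
    · exact (integrable_conj_entry (Matrix.single 0 0 1) i j).const_mul (d : ℂ)
  integral_eq i j := by
    have hm := (continuous_pureOrbit d).measurable.aemeasurable (μ := haarU d)
    rw [haarPure, integral_map hm]
    · have := integral_conj (Matrix.single 0 0 1 : Op d) (by simp) i j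
      rw [← this, ← integral_const_mul]
      rfl
    · exact ((continuous_const (y := (d : ℂ))).mul
        (continuous_pure_entry i j)).aestronglyMeasurable

/-! ### Distances and their weighting matrices -/

/-- Unitary invariance of a function of two states. -/
def UnitarilyInvariant {d : ℕ} (D : Op d → Op d → ℝ) : Prop :=
  ∀ (V : U d) (ρ σ : Op d), IsState ρ → IsState σ → D (conj V ρ) (conj V σ) = D ρ σ

/-- `W` is the weighting matrix of the squared distance `D²`: for every full-rank state `ρ`, the
superoperator `W(ρ)` is positive semidefinite and
`D(ρ, σ)² = ⟨⟨σ - ρ| W(ρ) |σ - ρ⟩⟩ + o(tr (σ - ρ)²)` as the state `σ` tends to `ρ`. -/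
def IsWeightOf {d : ℕ} (W : Op d → SuperOp d) (D : Op d → Op d → ℝ) : Prop :=
  ∀ ρ : Op d, IsFullRankState ρ →
    (W ρ).PosSemidef ∧
    (fun σ : Op d => D ρ σ ^ 2 - quadForm (W ρ) (σ - ρ))
      =o[𝓝[{σ | IsState σ}] ρ] (fun σ : Op d => ((σ - ρ)ᴴ * (σ - ρ)).trace.re)

/-- The Hilbert-Schmidt distance. -/
def hsDist {d : ℕ} (ρ σ : Op d) : ℝ := Real.sqrt (((ρ - σ)ᴴ * (ρ - σ)).trace.re)

/-- The positive square root of a positive semidefinite operator. -/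
def opSqrt {d : ℕ} (A : Op d) : Op d := cfc Real.sqrt A

/-- The Bures distance, `D_B(ρ, σ)² = 2 - 2 tr √(√ρ σ √ρ)`. -/
def buresDist {d : ℕ} (ρ σ : Op d) : ℝ :=
  Real.sqrt (2 - 2 * (opSqrt (opSqrt ρ * σ * opSqrt ρ)).trace.re)

/-- The weighting matrix of the Hilbert-Schmidt distance is the identity; its WMSE is the MSE. -/
def hsWeight {d : ℕ} (_ρ : Op d) : SuperOp d := 1

/-- The weighting matrix of the Bures distance: half the inverse of the superoperator
`X ↦ ρ X + X ρ`, so that `⟨⟨X|W|X⟩⟩ = (1/2) ∑_{jk} |⟨j|X|k⟩|² / (λ_j + λ_k)` in an eigenbasis of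
`ρ`. Its WMSE is the MSB. -/
def buresWeight {d : ℕ} (ρ : Op d) : SuperOp d :=
  (1 / 2 : ℂ) • ((1 : Op d) ⊗ₖ ρ + ρᵀ ⊗ₖ (1 : Op d))⁻¹

end QTomo

end

open Matrix MeasureTheory Topology
open scoped Kronecker ComplexOrder

noncomputable section

namespace QTomo

variable {d : ℕ}

/-! ### Positive semidefinite matrices -/

/-! Every figure of merit is a function of the frame superoperator. Since `F(σ)|σ⟩⟩ = |1⟩⟩`, the
error matrix is `C(σ) = F(σ)⁻¹ - |σ⟩⟩⟨⟨σ|` and its restricted determinant is `d / det F(σ)`. The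
WMSE is thus `Tr(W F⁻¹)` up to a term independent of the measurement, and the log-volume is a
constant minus `(log det F) / 2`. The first function of `F` is convex, the second too.

Pull `F(V ρ V†)` back to `ρ` by conjugation with `V` (`orbitFrame`). For the covariant measurement
the result is a fixed `G` (`covariant_orbitFrame`). For any measurement its Haar average is at most
`G` in the Loewner order (`integral_orbitFrame_form_le`). Indeed `|tr(A X)|² / tr(A ρ)` is
subadditive in the outcome `A ≥ 0` by Cauchy-Schwarz, so splitting `A` into rank-one pieces can only
increase it. By Haar invariance all rank-one pieces of the same trace have the same orbit average,
and the traces of all outcomes add up to `d`. The covariant measurement attains equality.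

Jensen's inequality and monotonicity then conclude. Both are carried out through the tangents at
`G`, `inv_tangent_le` and `log_det_le`, which are affine in the pulled-back frame and can be
integrated directly.

For the WMSE, the weighting matrix must also be pulled back. The distance determines `W` only on
traceless Hermitian operators, but the WMSE sees no more than that
(`IsIC.trace_mul_optMSEMatrix_congr`), so unitary invariance of `D` suffices. For the Bures
distance, the expansion follows from a Sylvester equation for `√(√ρ σ √ρ) - ρ`, compared with its
linearization. -/

theorem exists_eq_conjTranspose_mul_self {n : Type*} [Fintype n] [DecidableEq n]
    {A : Matrix n n ℂ} (hA : A.PosSemidef) : ∃ B : Matrix n n ℂ, A = Bᴴ * B := by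
  open scoped MatrixOrder in
  obtain ⟨B, hB⟩ := CStarAlgebra.nonneg_iff_eq_star_mul_self.mp hA.nonneg
  exact ⟨B, hB⟩

theorem trace_mul_nonneg {n : Type*} [Fintype n] [DecidableEq n] {A B : Matrix n n ℂ}
    (hA : A.PosSemidef) (hB : B.PosSemidef) : 0 ≤ (A * B).trace := by
  obtain ⟨C, rfl⟩ := exists_eq_conjTranspose_mul_self hA
  rw [Matrix.mul_assoc, Matrix.trace_mul_comm]
  exact (hB.mul_mul_conjTranspose_same C).trace_nonneg

theorem spectral_eq {n : Type*} [Fintype n] [DecidableEq n] {A : Matrix n n ℂ}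
    (hA : A.IsHermitian) :
    A = (hA.eigenvectorUnitary : Matrix n n ℂ) * diagonal (fun i => (hA.eigenvalues i : ℂ)) *
      (hA.eigenvectorUnitary : Matrix n n ℂ)ᴴ := by
  conv_lhs => rw [hA.spectral_theorem, Unitary.conjStarAlgAut_apply]
  rfl

/-- The smallest eigenvalue serves as `c`. This margin bounds outcome probabilities from below,
leaves room for perturbing a state, and controls Sylvester equations. -/
theorem PosDef.exists_sub_smul_one {n : Type*} [Fintype n] [DecidableEq n] [Nonempty n]
    {A : Matrix n n ℂ} (hA : A.PosDef) :
    ∃ c : ℝ, 0 < c ∧ (A - (c : ℂ) • (1 : Matrix n n ℂ)).PosSemidef := by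
  obtain ⟨i₀, h₀⟩ := Finite.exists_min hA.isHermitian.eigenvalues
  refine ⟨_, hA.eigenvalues_pos i₀, ?_⟩
  set c := hA.isHermitian.eigenvalues i₀
  have hU := Unitary.coe_mul_star_self hA.isHermitian.eigenvectorUnitary
  rw [Unitary.coe_star, star_eq_conjTranspose] at hU
  set V := (hA.isHermitian.eigenvectorUnitary : Matrix n n ℂ)
  have h : A - (c : ℂ) • (1 : Matrix n n ℂ) =
      V * diagonal (fun i => ((hA.isHermitian.eigenvalues i - c : ℝ) : ℂ)) * Vᴴ := by
    have h1 : diagonal (fun i => ((hA.isHermitian.eigenvalues i - c : ℝ) : ℂ)) =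
        diagonal (fun i => (hA.isHermitian.eigenvalues i : ℂ)) - (c : ℂ) • (1 : Matrix n n ℂ) := by
      ext i j
      by_cases hij : i = j <;> simp [hij]
    rw [h1, Matrix.mul_sub, Matrix.sub_mul, ← spectral_eq]
    simp [hU]
  rw [h]
  refine PosSemidef.mul_mul_conjTranspose_same (PosSemidef.diagonal fun i => ?_) V
  have := h₀ i
  simpa using this

/-! ### Unitary conjugation and orbits of full-rank states. -/

theorem conj_one (A : Op d) : conj 1 A = A := by simp [conj]

theorem conj_sub (V : U d) (A B : Op d) : conj V (A - B) = conj V A - conj V B := by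
  simp [conj, Matrix.mul_sub, Matrix.sub_mul]

theorem conj_smul (V : U d) (c : ℂ) (A : Op d) : conj V (c • A) = c • conj V A := by
  simp [conj]

theorem conj_add (V : U d) (A B : Op d) : conj V (A + B) = conj V A + conj V B := by
  simp [conj, Matrix.mul_add, Matrix.add_mul]

theorem coe_mul_star (V : U d) : (V : Op d) * (V : Op d)ᴴ = 1 :=
  Matrix.mem_unitaryGroup_iff.mp V.2

theorem conj_one_right (V : U d) : conj V (1 : Op d) = 1 := by simp [conj, coe_mul_star]

theorem trace_conj (V : U d) (A : Op d) : (conj V A).trace = A.trace := by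
  rw [conj, Matrix.trace_mul_comm, ← Matrix.mul_assoc, star_mul_coe, Matrix.one_mul]

theorem conj_mul_conj (V : U d) (A B : Op d) : conj V A * conj V B = conj V (A * B) := by
  calc (V : Op d) * A * (V : Op d)ᴴ * ((V : Op d) * B * (V : Op d)ᴴ)
      = (V : Op d) * A * ((V : Op d)ᴴ * (V : Op d)) * B * (V : Op d)ᴴ := by
        simp only [Matrix.mul_assoc]
    _ = _ := by rw [star_mul_coe]; simp [Matrix.mul_assoc, conj]

theorem conj_conjTranspose (V : U d) (A : Op d) : (conj V A)ᴴ = conj V Aᴴ := by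
  simp [conj, Matrix.mul_assoc]

theorem trace_conj_mul (V : U d) (A B : Op d) :
    (conj V A * B).trace = (A * conj V⁻¹ B).trace := by
  rw [← trace_conj V⁻¹, ← conj_mul_conj, ← conj_mul, inv_mul_cancel, conj_one]

theorem posSemidef_conj (V : U d) {A : Op d} (hA : A.PosSemidef) : (conj V A).PosSemidef :=
  hA.mul_mul_conjTranspose_same _

theorem IsFullRankState.conj {ρ : Op d} (hρ : IsFullRankState ρ) (V : U d) :
    IsFullRankState (conj V ρ) := by
  refine ⟨?_, by rw [trace_conj, hρ.2]⟩
  refine hρ.1.mul_mul_conjTranspose_same ?_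
  exact Matrix.vecMul_injective_of_isUnit (IsUnit.of_mul_eq_one _ (coe_mul_star V))

theorem IsFullRankState.isState {ρ : Op d} (hρ : IsFullRankState ρ) : IsState ρ :=
  ⟨hρ.1.posSemidef, hρ.2⟩

/-- Spectral decomposition into pure states that are unitarily equivalent to `|0⟩⟨0|`. -/
theorem exists_sum_conj_single [NeZero d] {A : Op d} (hA : A.IsHermitian) :
    ∃ W : Fin d → U d,
      A = ∑ k, (hA.eigenvalues k : ℂ) • conj (W k) (Matrix.single 0 0 1) := by
  -- The transposition of `0` and `k` carries `|0⟩⟨0|` to `|k⟩⟨k|`, which the eigenvector unitary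
  -- carries to the `k`-th eigenprojector.
  have hP : ∀ k : Fin d, (Equiv.swap 0 k).permMatrix ℂ ∈ U d := by
    intro k
    rw [Matrix.mem_unitaryGroup_iff, Matrix.star_eq_conjTranspose]
    simp only [Matrix.conjTranspose_permMatrix, ← Matrix.permMatrix_mul]
    simp
  refine ⟨fun k => hA.eigenvectorUnitary * ⟨_, hP k⟩, ?_⟩
  have h1 : ∀ k : Fin d, conj ⟨_, hP k⟩ (Matrix.single 0 0 1) = Matrix.single k k 1 := by
    intro k
    simp only [conj, Matrix.conjTranspose_permMatrix]
    ext i j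
    simp [Equiv.Perm.permMatrix, PEquiv.toMatrix_toPEquiv_mul, PEquiv.mul_toMatrix_toPEquiv,
      Matrix.single_apply, Equiv.swap_apply_def]
    grind
  simp_rw [conj_mul, h1]
  conv_lhs => rw [spectral_eq hA]
  have h2 : diagonal (fun i => (hA.eigenvalues i : ℂ)) =
      ∑ k, (hA.eigenvalues k : ℂ) • Matrix.single k k (1 : ℂ) := by
    simp [Matrix.smul_single, Matrix.sum_single_eq_diagonal]
  rw [h2, Matrix.mul_sum, Matrix.sum_mul]
  refine Finset.sum_congr rfl fun k _ => ?_
  rw [Matrix.mul_smul, Matrix.smul_mul]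
  rfl

theorem trace_eq_sum_eigenvalues {A : Op d} (hA : A.IsHermitian) :
    A.trace.re = ∑ k, hA.eigenvalues k := by
  rw [hA.trace_eq_sum_eigenvalues]
  simp

theorem norm_apply_le_trace {A : Op d} (hA : A.PosSemidef) (i j : Fin d) :
    ‖A i j‖ ≤ A.trace.re := by
  have : NeZero d := ⟨by rintro rfl; exact i.elim0⟩
  obtain ⟨W, hW⟩ := exists_sum_conj_single hA.isHermitian
  rw [trace_eq_sum_eigenvalues hA.isHermitian]
  conv_lhs => rw [hW]
  rw [Matrix.sum_apply]
  refine (norm_sum_le _ _).trans (Finset.sum_le_sum fun k _ => ?_)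
  rw [Matrix.smul_apply, smul_eq_mul, norm_mul, Complex.norm_real, Real.norm_eq_abs,
    abs_of_nonneg (hA.eigenvalues_nonneg k)]
  refine mul_le_of_le_one_right (hA.eigenvalues_nonneg k) ?_
  have : conj (W k) (Matrix.single 0 0 1) i j =
      (W k : Op d) i 0 * star ((W k : Op d) j 0) := by
    simp [conj, Matrix.mul_apply, Matrix.single_apply, Finset.sum_ite_eq, ite_and]
  rw [this, norm_mul, norm_star]
  exact mul_le_one₀ (entry_norm_bound_of_unitary (W k).2 _ _) (norm_nonneg _)
    (entry_norm_bound_of_unitary (W k).2 _ _)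

theorem trace_conjTranspose_mul_comm {A X : Op d} (hA : A.IsHermitian) :
    star (A * X).trace = (A * Xᴴ).trace := by
  rw [← Matrix.trace_conjTranspose, Matrix.conjTranspose_mul, hA.eq, Matrix.trace_mul_comm]

theorem trace_mul_eq_re {A X : Op d} (hA : A.IsHermitian) (hX : X.IsHermitian) :
    (A * X).trace = ((A * X).trace.re : ℂ) := by
  have := trace_conjTranspose_mul_comm (X := X) hA
  rw [hX.eq] at this
  exact (Complex.conj_eq_iff_re.mp this).symm

/-- A uniform lower bound on the outcome probabilities along the unitary orbit of a
full-rank state. -/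
theorem exists_orbit_lower_bound [NeZero d] {ρ : Op d} (hρ : IsFullRankState ρ) :
    ∃ c : ℝ, 0 < c ∧ ∀ (V : U d) (A : Op d), A.PosSemidef →
      c * A.trace.re ≤ (A * conj V ρ).trace.re := by
  obtain ⟨c, hc, h⟩ := PosDef.exists_sub_smul_one hρ.1
  refine ⟨c, hc, fun V A hA => ?_⟩
  -- Conjugation fixes the identity, so `V ρ V† ≥ c` with the same `c` for all `V`.
  have := trace_mul_nonneg hA (posSemidef_conj V h)
  rw [conj_sub, conj_smul, conj_one_right, Matrix.mul_sub, Matrix.trace_sub] at this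
  have := (Complex.le_def.mp this).1
  simp at this
  linarith

theorem trace_mul_conj_pos [NeZero d] {ρ : Op d} (hρ : IsFullRankState ρ) {A : Op d}
    (hA : A.PosSemidef) (hA0 : A ≠ 0) (V : U d) : 0 < (A * conj V ρ).trace.re := by
  obtain ⟨c, hc, h⟩ := exists_orbit_lower_bound hρ
  refine (mul_pos hc ?_).trans_le (h V A hA)
  have h0 := Complex.le_def.mp hA.trace_nonneg
  refine lt_of_le_of_ne h0.1 fun h1 => hA0 (hA.trace_eq_zero_iff.mp ?_)
  exact Complex.ext h1.symm h0.2.symm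

/-- Makes the Borel structure of `U d × U d` the product one, for Fubini with continuous functions.
-/
instance : SecondCountableTopology (U d) :=
  have : SecondCountableTopology (Op d) :=
    inferInstanceAs (SecondCountableTopology (Fin d → Fin d → ℂ))
  TopologicalSpace.Subtype.secondCountableTopology _

/-! ### The frame superoperator -/

/-- The integrand `|A⟩⟩ tr(A σ)⁻¹ ⟨⟨A|` of the frame superoperator. -/
def frameKernel (σ A : Op d) : SuperOp d := (((A * σ).trace.re : ℂ)⁻¹) • ketBra A A

theorem star_dotProduct_ketBra_mulVec (A : Op d) (x y : Fin d × Fin d → ℂ) :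
    star x ⬝ᵥ (ketBra A A *ᵥ y) = (star x ⬝ᵥ A.vec) * (star A.vec ⬝ᵥ y) := by
  rw [ketBra, Matrix.vecMulVec_mulVec, dotProduct_smul]
  simp

theorem trace_mul_ketBra (S : SuperOp d) (A : Op d) :
    (S * ketBra A A).trace = star A.vec ⬝ᵥ (S *ᵥ A.vec) := by
  rw [ketBra, Matrix.mul_vecMulVec, Matrix.trace_vecMulVec, dotProduct_comm]

/-- The numerator is quadratic in `A` and the denominator at least linear, so the kernel is
dominated by the trace, whose integral over the outcomes is finite. -/
theorem norm_frameKernel_le {c : ℝ} (hc : 0 < c) {σ A : Op d} (hA : A.PosSemidef)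
    (h : c * A.trace.re ≤ (A * σ).trace.re) (i j : Fin d × Fin d) :
    ‖frameKernel σ A i j‖ ≤ c⁻¹ * A.trace.re := by
  have h1 := norm_apply_le_trace hA i.2 i.1
  have h2 := norm_apply_le_trace hA j.2 j.1
  have h0 : 0 ≤ A.trace.re := (norm_nonneg _).trans h1
  have hp : 0 ≤ (A * σ).trace.re := (mul_nonneg hc.le h0).trans h
  have h3 : ‖frameKernel σ A i j‖ =
      ((A * σ).trace.re)⁻¹ * (‖A i.2 i.1‖ * ‖A j.2 j.1‖) := by
    simp [frameKernel, ketBra, Matrix.vecMulVec_apply, Matrix.vec, abs_of_nonneg hp]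
  rw [h3]
  rcases h0.eq_or_lt with h00 | h00
  · rw [← h00] at h1 ⊢
    rw [le_antisymm h1 (norm_nonneg _)]
    simp
  · have hp' : 0 < (A * σ).trace.re := (mul_pos hc h00).trans_le h
    calc ((A * σ).trace.re)⁻¹ * (‖A i.2 i.1‖ * ‖A j.2 j.1‖)
        ≤ (c * A.trace.re)⁻¹ * (A.trace.re * A.trace.re) := by gcongr
      _ = c⁻¹ * A.trace.re := by field_simp

theorem continuous_frameKernel_conj [NeZero d] {ρ : Op d} (hρ : IsFullRankState ρ) {A : Op d}
    (hA : A.PosSemidef) : Continuous fun V : U d => frameKernel (conj V ρ) A := by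
  by_cases hA0 : A = 0
  · simp only [hA0, frameKernel, ketBra, vec_zero, zero_vecMulVec, smul_zero]
    exact continuous_const
  have hp : Continuous fun V : U d => ((A * conj V ρ).trace.re : ℂ) :=
    Complex.continuous_ofReal.comp (Complex.continuous_re.comp
      (continuous_const.matrix_mul (continuous_conj ρ)).matrix_trace)
  exact (hp.inv₀ fun V => by exact_mod_cast (trace_mul_conj_pos hρ hA hA0 V).ne').smul
    continuous_const

namespace Measurement

variable {Ω : Type*} [MeasurableSpace Ω] (M : Measurement d Ω)

theorem frame_apply (σ : Op d) (i j : Fin d × Fin d) :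
    M.frame σ i j = ∫ ξ, frameKernel σ (M.op ξ) i j ∂M.ref := rfl

theorem integrable_trace_mul (X : Op d) :
    Integrable (fun ξ => (M.op ξ * X).trace) M.ref := by
  simp only [Matrix.trace, Matrix.diag, Matrix.mul_apply]
  exact integrable_finsetSum _ fun i _ => integrable_finsetSum _ fun j _ =>
    (M.integrable i j).mul_const _

theorem integral_trace_mul (X : Op d) : ∫ ξ, (M.op ξ * X).trace ∂M.ref = X.trace := by
  simp only [Matrix.trace, Matrix.diag, Matrix.mul_apply]
  rw [integral_finsetSum _ fun i _ => integrable_finsetSum _ fun j _ =>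
    (M.integrable i j).mul_const _]
  refine Finset.sum_congr rfl fun i _ => ?_
  rw [integral_finsetSum _ fun j _ => (M.integrable i j).mul_const _]
  simp_rw [integral_mul_const, M.integral_eq]
  simp [Matrix.one_apply]

theorem integrable_trace_re : Integrable (fun ξ => (M.op ξ).trace.re) M.ref := by
  have := (M.integrable_trace_mul 1).re
  simpa using this

theorem integral_trace_re : ∫ ξ, (M.op ξ).trace.re ∂M.ref = d := by
  have h1 := M.integral_trace_mul 1
  have h2 := integral_re (M.integrable_trace_mul 1)
  rw [h1] at h2
  simpa using h2

theorem aestronglyMeasurable_frameKernel (σ : Op d) (i j : Fin d × Fin d) :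
    AEStronglyMeasurable (fun ξ => frameKernel σ (M.op ξ) i j) M.ref := by
  have h1 := (Complex.measurable_ofReal.comp_aemeasurable
    (M.integrable_trace_mul σ).re.aestronglyMeasurable.aemeasurable).inv.aestronglyMeasurable
  refine h1.mul (AEStronglyMeasurable.mul (M.integrable i.2 i.1).aestronglyMeasurable ?_)
  exact continuous_star.comp_aestronglyMeasurable (M.integrable j.2 j.1).aestronglyMeasurable

theorem integrable_frameKernel [NeZero d] {σ : Op d} (hσ : IsFullRankState σ)
    (i j : Fin d × Fin d) : Integrable (fun ξ => frameKernel σ (M.op ξ) i j) M.ref := by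
  obtain ⟨c, hc, h⟩ := exists_orbit_lower_bound hσ
  refine (M.integrable_trace_re.const_mul c⁻¹).mono'
    (M.aestronglyMeasurable_frameKernel σ i j) (Filter.Eventually.of_forall fun ξ => ?_)
  exact norm_frameKernel_le hc (M.posSemidef ξ)
    (by simpa [conj_one] using h 1 _ (M.posSemidef ξ)) i j

theorem continuous_frame_conj [NeZero d] {ρ : Op d} (hρ : IsFullRankState ρ) :
    Continuous fun V : U d => M.frame (conj V ρ) := by
  obtain ⟨c, hc, h⟩ := exists_orbit_lower_bound hρ
  refine continuous_matrix fun i j => ?_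
  simp only [frame_apply]
  refine continuous_of_dominated (bound := fun ξ => c⁻¹ * (M.op ξ).trace.re)
    (fun V => M.aestronglyMeasurable_frameKernel _ i j)
    (fun V => Filter.Eventually.of_forall fun ξ => ?_) (M.integrable_trace_re.const_mul _)
    (Filter.Eventually.of_forall fun ξ => ?_)
  · exact norm_frameKernel_le hc (M.posSemidef ξ) (h V _ (M.posSemidef ξ)) i j
  · exact (continuous_frameKernel_conj hρ (M.posSemidef ξ)).matrix_elem i j

theorem integrable_trace_mul_frameKernel [NeZero d] {σ : Op d} (hσ : IsFullRankState σ)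
    (S : SuperOp d) : Integrable (fun ξ => (S * frameKernel σ (M.op ξ)).trace) M.ref := by
  simp only [Matrix.trace, Matrix.diag, Matrix.mul_apply]
  exact integrable_finsetSum _ fun i _ => integrable_finsetSum _ fun j _ =>
    (M.integrable_frameKernel hσ j i).const_mul _

theorem trace_mul_frame [NeZero d] {σ : Op d} (hσ : IsFullRankState σ) (S : SuperOp d) :
    (S * M.frame σ).trace = ∫ ξ, (S * frameKernel σ (M.op ξ)).trace ∂M.ref := by
  have h : ∀ i j, Integrable (fun ξ => S i j * frameKernel σ (M.op ξ) j i) M.ref :=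
    fun i j => (M.integrable_frameKernel hσ j i).const_mul _
  simp only [Matrix.trace, Matrix.diag, Matrix.mul_apply]
  rw [integral_finsetSum _ fun i _ => integrable_finsetSum _ fun j _ => h i j]
  refine Finset.sum_congr rfl fun i _ => ?_
  rw [integral_finsetSum _ fun j _ => h i j]
  simp_rw [integral_const_mul]
  rfl

theorem prob_nonneg {σ : Op d} (hσ : σ.PosSemidef) (ξ : Ω) : 0 ≤ M.prob σ ξ :=
  (Complex.le_def.mp (trace_mul_nonneg (M.posSemidef ξ) hσ)).1

/-- Full rank bounds `tr Π_ξ` by a multiple of `p_ξ`. Outcomes at which `p_ξ⁻¹` takes its default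
value therefore contribute nothing. -/
theorem op_eq_zero_of_prob_eq_zero [NeZero d] {σ : Op d} (hσ : IsFullRankState σ) {ξ : Ω}
    (h : M.prob σ ξ = 0) : M.op ξ = 0 := by
  obtain ⟨c, hc, hle⟩ := exists_orbit_lower_bound hσ
  have h1 := hle 1 _ (M.posSemidef ξ)
  rw [conj_one] at h1
  have h0 := Complex.le_def.mp (M.posSemidef ξ).trace_nonneg
  refine (M.posSemidef ξ).trace_eq_zero_iff.mp (Complex.ext ?_ h0.2.symm)
  have h2 : c * (M.op ξ).trace.re ≤ 0 := h1.trans h.le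
  exact le_antisymm (nonpos_of_mul_nonpos_right h2 hc) h0.1

theorem star_vec_dotProduct_op (ξ : Ω) (X : Op d) :
    star (M.op ξ).vec ⬝ᵥ X.vec = (M.op ξ * X).trace := by
  rw [star_vec_dotProduct_vec, (M.posSemidef ξ).isHermitian.eq]

theorem star_dotProduct_vec_op (ξ : Ω) (X : Op d) :
    star X.vec ⬝ᵥ (M.op ξ).vec = star (M.op ξ * X).trace := by
  rw [← star_vec_dotProduct_op, star_dotProduct]

/-- The quadratic form of the frame superoperator. -/
theorem star_dotProduct_frame_mulVec [NeZero d] {σ : Op d} (hσ : IsFullRankState σ) (X : Op d) :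
    star X.vec ⬝ᵥ (M.frame σ *ᵥ X.vec) =
      ((∫ ξ, (M.prob σ ξ)⁻¹ * ‖(M.op ξ * X).trace‖ ^ 2 ∂M.ref : ℝ) : ℂ) ∧
    Integrable (fun ξ => (M.prob σ ξ)⁻¹ * ‖(M.op ξ * X).trace‖ ^ 2) M.ref := by
  have h1 : star X.vec ⬝ᵥ (M.frame σ *ᵥ X.vec) =
      (vecMulVec X.vec (star X.vec) * M.frame σ).trace := by
    rw [Matrix.trace_mul_comm, Matrix.mul_vecMulVec, Matrix.trace_vecMulVec, dotProduct_comm]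
  have h2 : ∀ ξ, (vecMulVec X.vec (star X.vec) * frameKernel σ (M.op ξ)).trace =
      (((M.prob σ ξ)⁻¹ * ‖(M.op ξ * X).trace‖ ^ 2 : ℝ) : ℂ) := by
    intro ξ
    rw [Matrix.trace_mul_comm, Matrix.mul_vecMulVec, Matrix.trace_vecMulVec, dotProduct_comm,
      frameKernel, Matrix.smul_mulVec, dotProduct_smul, star_dotProduct_ketBra_mulVec,
      star_vec_dotProduct_op, star_dotProduct_vec_op, smul_eq_mul, mul_comm (star _)]
    have := Complex.mul_conj' (M.op ξ * X).trace
    rw [← starRingEnd_apply, this]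
    simp [prob]
  refine ⟨?_, ?_⟩
  · rw [h1, M.trace_mul_frame hσ]
    simp_rw [h2]
    exact integral_ofReal
  · have := (M.integrable_trace_mul_frameKernel hσ (vecMulVec X.vec (star X.vec))).re
    simp_rw [h2] at this
    exact this

theorem frame_mulVec [NeZero d] {σ : Op d} (hσ : IsFullRankState σ) (X : Op d) :
    M.frame σ *ᵥ X.vec = (Matrix.of fun i j =>
      ∫ ξ, ((M.prob σ ξ)⁻¹ : ℂ) * (M.op ξ * X).trace * M.op ξ i j ∂M.ref).vec := by
  ext ⟨j, i⟩
  have h : ∀ ξ, ((M.prob σ ξ)⁻¹ : ℂ) * (M.op ξ * X).trace * M.op ξ i j =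
      ∑ k, frameKernel σ (M.op ξ) (j, i) k * X.vec k := by
    intro ξ
    rw [← star_vec_dotProduct_op, dotProduct, Finset.mul_sum, Finset.sum_mul]
    refine Finset.sum_congr rfl fun k _ => ?_
    simp only [frameKernel, ketBra, Matrix.smul_apply, vecMulVec_apply, smul_eq_mul, vec, prob]
    ring
  simp only [Matrix.vec, Matrix.of_apply, h]
  rw [integral_finsetSum _ fun k _ => (M.integrable_frameKernel hσ _ k).mul_const _]
  simp_rw [integral_mul_const]
  rfl

/-- The factor `tr(Π_ξ σ) = p_ξ` cancels the weight `1 / p_ξ` and leaves `∫ Π_ξ dξ = 1`. -/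
theorem frame_mulVec_state [NeZero d] {σ : Op d} (hσ : IsFullRankState σ) :
    M.frame σ *ᵥ σ.vec = (1 : Op d).vec := by
  rw [M.frame_mulVec hσ, vec_inj]
  ext i j
  rw [Matrix.of_apply, ← M.integral_eq]
  refine integral_congr_ae (Filter.Eventually.of_forall fun ξ => ?_)
  simp only
  by_cases h : M.prob σ ξ = 0
  · simp [M.op_eq_zero_of_prob_eq_zero hσ h]
  · rw [trace_mul_eq_re (M.posSemidef ξ).isHermitian hσ.1.isHermitian]
    change _ * (M.prob σ ξ : ℂ) * _ = _
    rw [inv_mul_cancel₀ (by exact_mod_cast h), one_mul]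

/-- The outcome operators are Hermitian, so the frame superoperator commutes with the adjoint; this
makes the reconstruction operators Hermitian. -/
theorem frame_mulVec_conjTranspose [NeZero d] {σ : Op d} (hσ : IsFullRankState σ) {X Y : Op d}
    (h : M.frame σ *ᵥ X.vec = Y.vec) : M.frame σ *ᵥ Xᴴ.vec = Yᴴ.vec := by
  rw [M.frame_mulVec hσ, vec_inj] at h ⊢
  subst h
  ext i j
  simp only [Matrix.of_apply, Matrix.conjTranspose_apply]
  rw [← starRingEnd_apply, ← _root_.integral_conj]
  refine integral_congr_ae (Filter.Eventually.of_forall fun ξ => ?_)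
  simp only [map_mul, starRingEnd_apply]
  rw [trace_conjTranspose_mul_comm (M.posSemidef ξ).isHermitian,
    (M.posSemidef ξ).isHermitian.apply]
  simp [star_inv₀]

theorem frame_isHermitian (σ : Op d) : (M.frame σ).IsHermitian := by
  ext i j
  rw [Matrix.conjTranspose_apply, frame_apply, frame_apply, ← starRingEnd_apply, ← _root_.integral_conj]
  refine integral_congr_ae (Filter.Eventually.of_forall fun ξ => ?_)
  simp [frameKernel, ketBra, vecMulVec_apply, mul_comm]

end Measurement

/-- A Hermitian traceless perturbation of a full-rank state is a state, as long as it is small. -/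
theorem eventually_isState_add_smul [NeZero d] {ρ X : Op d} (hρ : IsFullRankState ρ)
    (hX : X.IsHermitian) (htr : X.trace = 0) :
    ∀ᶠ t : ℝ in 𝓝 0, IsState (ρ + (t : ℂ) • X) := by
  obtain ⟨c, hc, h⟩ := PosDef.exists_sub_smul_one hρ.1
  have hev : ∀ᶠ t : ℝ in 𝓝 0, ∀ k, |t| * |hX.eigenvalues k| < c := by
    refine Filter.eventually_all.mpr fun k => ?_
    have : Continuous fun t : ℝ => |t| * |hX.eigenvalues k| := by fun_prop
    exact this.continuousAt.eventually_lt continuousAt_const (by simpa using hc)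
  filter_upwards [hev] with t ht
  refine ⟨?_, by simp [htr, hρ.2]⟩
  -- Split `ρ + t X` as `(ρ - c) + (c + t X)`; the second term is positive once `|t|` times each
  -- eigenvalue of `X` is below `c` in absolute value.
  have h1 : ((c : ℂ) • (1 : Op d) + (t : ℂ) • X).PosSemidef := by
    have hU := coe_mul_star hX.eigenvectorUnitary
    have h2 : (c : ℂ) • (1 : Op d) + (t : ℂ) • X = conj hX.eigenvectorUnitary
        (diagonal fun i => ((c + t * hX.eigenvalues i : ℝ) : ℂ)) := by
      have h3 : diagonal (fun i => ((c + t * hX.eigenvalues i : ℝ) : ℂ)) =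
          (c : ℂ) • (1 : Op d) + (t : ℂ) • diagonal (fun i => (hX.eigenvalues i : ℂ)) := by
        ext i j
        by_cases hij : i = j <;> simp [hij]
      rw [h3, conj_add, conj_smul, conj_smul, conj_one_right]
      congr 2
      exact spectral_eq hX
    rw [h2]
    refine posSemidef_conj _ (PosSemidef.diagonal fun i => ?_)
    have h4 := ht i
    rw [← abs_mul] at h4
    have h5 := (abs_lt.mp h4).1
    simp only [Pi.zero_apply, Complex.zero_le_real]
    linarith
  have := h.add h1
  convert this using 1
  abel

namespace Measurement

variable {Ω : Type*} [MeasurableSpace Ω] (M : Measurement d Ω)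

/-- An informationally complete measurement separates Hermitian operators. -/
theorem IsIC.eq_zero_of_isHermitian [NeZero d] {M : Measurement d Ω} (hM : M.IsIC) {ρ A : Op d}
    (hρ : IsFullRankState ρ) (hA : A.IsHermitian)
    (h : ∀ᵐ ξ ∂M.ref, (M.op ξ * A).trace.re = 0) : A = 0 := by
  -- Integrating the vanishing statistics against `∫ Π_ξ dξ = 1` gives the trace, so `ρ + t A` stays
  -- normalized and cannot be told from `ρ`.
  have htr : A.trace = 0 := by
    rw [← M.integral_trace_mul A]
    refine integral_eq_zero_of_ae ?_
    filter_upwards [h] with ξ hξ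
    rw [trace_mul_eq_re (M.posSemidef ξ).isHermitian hA, hξ]
    rfl
  have hev := eventually_isState_add_smul hρ hA htr
  obtain ⟨t, ht, ht0⟩ : ∃ t : ℝ, IsState (ρ + (t : ℂ) • A) ∧ t ≠ 0 :=
    ((hev.filter_mono nhdsWithin_le_nhds).and (self_mem_nhdsWithin (s := {0}ᶜ))).exists
  have := hM _ _ hρ.isState ht (by
    filter_upwards [h] with ξ hξ
    simp [prob, Matrix.mul_add, hξ])
  have h0 : (t : ℂ) • A = 0 := by simpa using this
  exact (smul_eq_zero.mp h0).resolve_left (by exact_mod_cast ht0)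

/-- The quadratic form is `∫ |tr(Π_ξ X)|² / p_ξ dξ`. If it vanishes then so does `tr(Π_ξ X)` almost
everywhere, and informational completeness applies to the Hermitian operators `X + X†` and `i(X -
X†)`. -/
theorem IsIC.posDef_frame [NeZero d] {M : Measurement d Ω} (hM : M.IsIC) {σ : Op d}
    (hσ : IsFullRankState σ) : (M.frame σ).PosDef := by
  refine PosDef.of_dotProduct_mulVec_pos (M.frame_isHermitian σ) fun x hx => ?_
  obtain ⟨X, rfl⟩ := vec_bijective.surjective x
  obtain ⟨h1, h2⟩ := M.star_dotProduct_frame_mulVec hσ X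
  rw [h1]
  have h0 : 0 ≤ fun ξ => (M.prob σ ξ)⁻¹ * ‖(M.op ξ * X).trace‖ ^ 2 := fun ξ =>
    mul_nonneg (inv_nonneg.mpr (M.prob_nonneg hσ.1.posSemidef ξ)) (by positivity)
  refine Complex.zero_lt_real.mpr (lt_of_le_of_ne (integral_nonneg h0) fun h3 => hx ?_)
  rw [vec_eq_zero_iff]
  have h4 := (integral_eq_zero_iff_of_nonneg h0 h2).mp h3.symm
  have h5 : ∀ᵐ ξ ∂M.ref, (M.op ξ * X).trace = 0 := by
    filter_upwards [h4] with ξ hξ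
    by_cases hp : M.prob σ ξ = 0
    · simp [M.op_eq_zero_of_prob_eq_zero hσ hp]
    · simpa [hp] using hξ
  have h6 : ∀ᵐ ξ ∂M.ref, (M.op ξ * Xᴴ).trace = 0 := by
    filter_upwards [h5] with ξ hξ
    rw [← trace_conjTranspose_mul_comm (M.posSemidef ξ).isHermitian, hξ, star_zero]
  have hA : X + Xᴴ = 0 := hM.eq_zero_of_isHermitian hσ (isHermitian_add_transpose_self X) (by
    filter_upwards [h5, h6] with ξ a b
    simp [Matrix.mul_add, a, b])
  have hB : Complex.I • (X - Xᴴ) = 0 := by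
    refine hM.eq_zero_of_isHermitian hσ ?_ ?_
    · simp [Matrix.IsHermitian, Matrix.conjTranspose_smul, ← smul_neg]
    · filter_upwards [h5, h6] with ξ a b
      simp [Matrix.mul_sub, a, b]
  have hB' := (smul_eq_zero.mp hB).resolve_left Complex.I_ne_zero
  have : (2 : ℂ) • X = 0 := by
    rw [two_smul]
    calc X + X = (X + Xᴴ) + (X - Xᴴ) := by abel
      _ = 0 := by rw [hA, hB', add_zero]
  exact (smul_eq_zero.mp this).resolve_left two_ne_zero

end Measurement

/-! ### The scaled MSE matrix -/

theorem star_one_vec_dotProduct (A : Op d) : star (1 : Op d).vec ⬝ᵥ A.vec = A.trace := by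
  rw [star_vec_dotProduct_vec, conjTranspose_one, Matrix.one_mul]

theorem star_vec_dotProduct_one (A : Op d) : star A.vec ⬝ᵥ (1 : Op d).vec = star A.trace := by
  rw [star_vec_dotProduct_vec, Matrix.mul_one, Matrix.trace_conjTranspose]

theorem mul_vecMulVec_star_mul {n : Type*} [Fintype n] (T : Matrix n n ℂ) (x : n → ℂ) :
    T * vecMulVec x (star x) * Tᴴ = vecMulVec (T *ᵥ x) (star (T *ᵥ x)) := by
  rw [Matrix.mul_vecMulVec, Matrix.vecMulVec_mul, star_mulVec]

namespace Measurement

variable {Ω : Type*} [MeasurableSpace Ω] {M : Measurement d Ω}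

theorem IsIC.isUnit_det_frame [NeZero d] (hM : M.IsIC) {σ : Op d} (hσ : IsFullRankState σ) :
    IsUnit (M.frame σ).det :=
  (Matrix.isUnit_iff_isUnit_det _).mp (hM.posDef_frame hσ).isUnit

theorem IsIC.frame_inv_mulVec_one [NeZero d] (hM : M.IsIC) {σ : Op d} (hσ : IsFullRankState σ) :
    (M.frame σ)⁻¹ *ᵥ (1 : Op d).vec = σ.vec := by
  rw [← M.frame_mulVec_state hσ, Matrix.mulVec_mulVec,
    Matrix.nonsing_inv_mul _ (hM.isUnit_det_frame hσ), Matrix.one_mulVec]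

theorem mul_frame_mul_apply [NeZero d] {σ : Op d} (hσ : IsFullRankState σ)
    (S T : SuperOp d) (i j : Fin d × Fin d) :
    (S * M.frame σ * T) i j = ∫ ξ, (S * frameKernel σ (M.op ξ) * T) i j ∂M.ref := by
  have h : ∀ A : SuperOp d, (S * A * T) i j = (vecMulVec (T.col j) (S.row i) * A).trace := by
    intro A
    rw [Matrix.vecMulVec_mul, Matrix.trace_vecMulVec, dotProduct_comm]
    rfl
  simp_rw [h]
  exact M.trace_mul_frame hσ _

/-- The optimal MSE matrix is `F(σ)⁻¹ - |σ⟩⟩⟨⟨σ|`. -/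
theorem IsIC.optMSEMatrix_eq [NeZero d] (hM : M.IsIC) {σ : Op d} (hσ : IsFullRankState σ) :
    M.optMSEMatrix σ = (M.frame σ)⁻¹ - ketBra σ σ := by
  have hF := hM.isUnit_det_frame hσ
  have hH : ((M.frame σ)⁻¹)ᴴ = (M.frame σ)⁻¹ := (M.frame_isHermitian σ).inv.eq
  rw [optMSEMatrix, mseMatrix]
  congr 1
  have h1 : (M.frame σ)⁻¹ = (M.frame σ)⁻¹ * M.frame σ * ((M.frame σ)⁻¹)ᴴ := by
    rw [Matrix.nonsing_inv_mul _ hF, Matrix.one_mul, hH]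
  ext i j
  conv_rhs => rw [h1]
  rw [mul_frame_mul_apply hσ, Matrix.of_apply]
  refine integral_congr_ae (Filter.Eventually.of_forall fun ξ => ?_)
  simp only
  rw [frameKernel, Matrix.mul_smul, Matrix.smul_mul, ketBra, ketBra, mul_vecMulVec_star_mul]
  have h2 : (M.optRec σ ξ).vec = ((M.prob σ ξ)⁻¹ : ℂ) • ((M.frame σ)⁻¹ *ᵥ (M.op ξ).vec) := by
    ext ⟨k, l⟩
    simp [optRec, Matrix.vec]
  rw [h2]
  simp only [vecMulVec_apply, Matrix.smul_apply, Pi.smul_apply, Pi.star_apply, smul_eq_mul,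
    star_mul']
  change _ = (M.prob σ ξ : ℂ)⁻¹ * _
  have h3 : star ((M.prob σ ξ : ℂ)⁻¹) = (M.prob σ ξ : ℂ)⁻¹ := by simp [star_inv₀]
  rw [h3]
  -- The identity `p * p⁻¹ * p⁻¹ = p⁻¹` survives at `p = 0`, where both sides are zero.
  by_cases hp : (M.prob σ ξ : ℂ) = 0
  · simp [hp]
  · field_simp

/-- The part `Y ↦ F(σ)⁻¹ Y - tr(F(σ)⁻¹ Y) σ` of the reconstruction, orthogonal to the identity. -/
def recSuperOp (M : Measurement d Ω) (σ : Op d) : SuperOp d :=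
  (1 - ketBra σ 1) * (M.frame σ)⁻¹

/-- In this form the error matrix is an integral of `|X_ξ⟩⟩⟨⟨X_ξ| / p_ξ` with `X_ξ` the image of
`Π_ξ`, and these images are traceless and Hermitian. The cross terms collapse because `F⁻¹|1⟩⟩ =
|σ⟩⟩` and `tr σ = 1`. -/
theorem IsIC.optMSEMatrix_eq_recSuperOp [NeZero d] (hM : M.IsIC) {σ : Op d}
    (hσ : IsFullRankState σ) :
    M.optMSEMatrix σ = M.recSuperOp σ * M.frame σ * (M.recSuperOp σ)ᴴ := by
  have hF := hM.isUnit_det_frame hσ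
  have hH : ((M.frame σ)⁻¹)ᴴ = (M.frame σ)⁻¹ := (M.frame_isHermitian σ).inv.eq
  have h1 := hM.frame_inv_mulVec_one hσ
  have h2 : (M.frame σ)⁻¹ * ketBra 1 σ = ketBra σ σ := by
    rw [ketBra, Matrix.mul_vecMulVec, h1, ketBra]
  have h3 : ketBra σ 1 * (M.frame σ)⁻¹ = ketBra σ σ := by
    have := congrArg conjTranspose h2
    rw [Matrix.conjTranspose_mul, hH] at this
    simpa [ketBra, conjTranspose_vecMulVec] using this
  have h4 : (ketBra σ 1)ᴴ = ketBra 1 σ := by simp [ketBra, conjTranspose_vecMulVec]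
  have h5 : ketBra σ σ * ketBra 1 σ = ketBra σ σ := by
    rw [ketBra, ketBra, Matrix.vecMulVec_mul_vecMulVec, star_vec_dotProduct_one, hσ.2]
    simp
  rw [hM.optMSEMatrix_eq hσ, recSuperOp, Matrix.mul_assoc (1 - ketBra σ 1),
    Matrix.nonsing_inv_mul _ hF, Matrix.conjTranspose_mul, hH, Matrix.mul_one,
    ← Matrix.mul_assoc, Matrix.sub_mul, Matrix.one_mul, h3, Matrix.conjTranspose_sub,
    Matrix.conjTranspose_one, h4, Matrix.mul_sub, Matrix.mul_one,
    Matrix.sub_mul _ _ (ketBra 1 σ), h5, h2]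
  simp

theorem IsIC.exists_recSuperOp_mulVec [NeZero d] (hM : M.IsIC) {σ : Op d}
    (hσ : IsFullRankState σ) {A : Op d} (hA : A.IsHermitian) :
    ∃ X : Op d, X.IsHermitian ∧ X.trace = 0 ∧ M.recSuperOp σ *ᵥ A.vec = X.vec := by
  have hF := hM.isUnit_det_frame hσ
  obtain ⟨Y, hY⟩ := vec_bijective.surjective ((M.frame σ)⁻¹ *ᵥ A.vec)
  have h1 : M.frame σ *ᵥ Y.vec = A.vec := by
    rw [hY, Matrix.mulVec_mulVec, Matrix.mul_nonsing_inv _ hF, Matrix.one_mulVec]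
  have h2 := M.frame_mulVec_conjTranspose hσ h1
  rw [hA.eq, ← h1] at h2
  have hYH : Yᴴ = Y := by
    rw [← vec_inj]
    have := congrArg ((M.frame σ)⁻¹ *ᵥ ·) h2
    simpa only [Matrix.mulVec_mulVec, Matrix.nonsing_inv_mul _ hF, Matrix.one_mulVec] using this
  -- Here `Y` is the preimage of `A` under the frame; removing `tr(Y) σ` kills the trace because `tr
  -- σ = 1`.
  refine ⟨Y - Y.trace • σ, ?_, ?_, ?_⟩
  · have ht : star Y.trace = Y.trace := by rw [← Matrix.trace_conjTranspose, hYH]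
    rw [Matrix.IsHermitian, Matrix.conjTranspose_sub, Matrix.conjTranspose_smul, hYH, ht,
      hσ.1.isHermitian.eq]
  · simp [hσ.2]
  · rw [recSuperOp, ← Matrix.mulVec_mulVec, ← hY, Matrix.sub_mulVec, Matrix.one_mulVec, ketBra,
      Matrix.vecMulVec_mulVec, star_one_vec_dotProduct]
    simp

/-- The WMSE depends only on the quadratic form of the weighting matrix on traceless Hermitian
operators. -/
theorem IsIC.trace_mul_optMSEMatrix_congr [NeZero d] (hM : M.IsIC) {σ : Op d}
    (hσ : IsFullRankState σ) {W W' : SuperOp d}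
    (h : ∀ X : Op d, X.IsHermitian → X.trace = 0 → quadForm W X = quadForm W' X) :
    (W * M.optMSEMatrix σ).trace.re = (W' * M.optMSEMatrix σ).trace.re := by
  have h1 : ∀ S : SuperOp d, (S * M.optMSEMatrix σ).trace.re = ∫ ξ, (M.prob σ ξ)⁻¹ *
      (star (M.recSuperOp σ *ᵥ (M.op ξ).vec) ⬝ᵥ (S *ᵥ (M.recSuperOp σ *ᵥ (M.op ξ).vec))).re
      ∂M.ref := by
    intro S
    set T := M.recSuperOp σ
    have h2 : (S * M.optMSEMatrix σ).trace = ((Tᴴ * S * T) * M.frame σ).trace := by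
      rw [hM.optMSEMatrix_eq_recSuperOp hσ, Matrix.mul_assoc Tᴴ, Matrix.mul_assoc Tᴴ,
        Matrix.trace_mul_comm Tᴴ]
      simp only [Matrix.mul_assoc, T]
    rw [h2, M.trace_mul_frame hσ]
    refine (integral_re (M.integrable_trace_mul_frameKernel hσ _)).symm.trans ?_
    refine integral_congr_ae (Filter.Eventually.of_forall fun ξ => ?_)
    simp only [frameKernel, Matrix.mul_smul, Matrix.trace_smul, trace_mul_ketBra]
    have h3 : star (M.op ξ).vec ⬝ᵥ (Tᴴ * S * T) *ᵥ (M.op ξ).vec =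
        star (T *ᵥ (M.op ξ).vec) ⬝ᵥ S *ᵥ T *ᵥ (M.op ξ).vec := by
      rw [star_mulVec, ← dotProduct_mulVec, Matrix.mulVec_mulVec, Matrix.mulVec_mulVec,
        Matrix.mul_assoc]
    rw [h3, smul_eq_mul, ← Complex.ofReal_inv]
    exact Complex.re_ofReal_mul _ _
  rw [h1, h1]
  refine integral_congr_ae (Filter.Eventually.of_forall fun ξ => ?_)
  obtain ⟨X, hX, htr, hv⟩ := hM.exists_recSuperOp_mulVec hσ (M.posSemidef ξ).isHermitian
  simp only [hv]
  congr 1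
  exact h X hX htr

end Measurement

/-! ### The volume of the uncertainty ellipsoid -/

/-- The kets as a direct sum of the traceless ones and the multiples of the identity. -/
def ketEquiv (d : ℕ) [NeZero d] : (Fin d × Fin d → ℂ) ≃ₗ[ℂ] tracelessKets d × ℂ :=
  LinearEquiv.ofLinearMap
    ((tracelessProj d).prod (∑ i : Fin d, LinearMap.proj (i, i)))
    ((tracelessKets d).subtype.coprod
      ((LinearMap.id : ℂ →ₗ[ℂ] ℂ).smulRight ((d : ℂ)⁻¹ • (1 : Op d).vec)))
    (by
      have hd : (d : ℂ) ≠ 0 := by exact_mod_cast NeZero.ne d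
      ext v
      · obtain ⟨v, hv⟩ := v
        rw [mem_tracelessKets] at hv
        simp [tracelessProj, hv]
      · obtain ⟨v, hv⟩ := v
        rw [mem_tracelessKets] at hv
        simp [hv]
      · simp [tracelessProj, hd]
      · simp [hd])
    (by
      ext v
      simp [tracelessProj]
      ring)

/-- Since `O` annihilates the identity on both sides, adding the projector onto it gives a
block-diagonal map with a block `1`, which leaves the determinant unchanged. -/
theorem barDet_eq_det [NeZero d] (O : SuperOp d) (h1 : O *ᵥ (1 : Op d).vec = 0)
    (h2 : star (1 : Op d).vec ᵥ* O = 0) :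
    barDet O = (O + (d : ℂ)⁻¹ • ketBra (1 : Op d) 1).det := by
  have hd : (d : ℂ) ≠ 0 := by exact_mod_cast NeZero.ne d
  have hsum : ∀ v : Fin d × Fin d → ℂ, ∑ i : Fin d, v (i, i) = star (1 : Op d).vec ⬝ᵥ v := by
    intro v
    obtain ⟨X, rfl⟩ := vec_bijective.surjective v
    rw [star_one_vec_dotProduct]
    rfl
  rw [barDet, ← LinearMap.det_toLin', ← LinearMap.det_conj _ (ketEquiv d)]
  have h : (ketEquiv d : (Fin d × Fin d → ℂ) →ₗ[ℂ] tracelessKets d × ℂ) ∘ₗ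
      toLin' (O + (d : ℂ)⁻¹ • ketBra (1 : Op d) 1) ∘ₗ ((ketEquiv d).symm : _ →ₗ[ℂ] _) =
      LinearMap.prodMap (tracelessProj d ∘ₗ O.mulVecLin ∘ₗ (tracelessKets d).subtype)
        LinearMap.id := by
    refine LinearMap.ext fun x => ?_
    obtain ⟨t, z⟩ := x
    have e1 : (ketEquiv d).symm (t, z) =
        t.1 + (ketEquiv d).symm (0, z) := by simp [ketEquiv]
    have e2 : (ketEquiv d).symm (0, z) = z • (d : ℂ)⁻¹ • (1 : Op d).vec := by simp [ketEquiv]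
    have e3 : star (1 : Op d).vec ⬝ᵥ t.1 = 0 := by
      rw [← hsum]; exact (mem_tracelessKets _).mp t.2
    have e4 : star (1 : Op d).vec ⬝ᵥ (1 : Op d).vec = d := by
      rw [star_one_vec_dotProduct]; simp
    have e5 : (O + (d : ℂ)⁻¹ • ketBra (1 : Op d) 1) *ᵥ (ketEquiv d).symm (t, z) =
        O *ᵥ t.1 + (ketEquiv d).symm (0, z) := by
      rw [e1, e2, Matrix.mulVec_add, Matrix.add_mulVec, Matrix.mulVec_smul, Matrix.mulVec_smul,
        Matrix.add_mulVec, h1, Matrix.smul_mulVec, Matrix.smul_mulVec, ketBra,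
        Matrix.vecMulVec_mulVec, Matrix.vecMulVec_mulVec, e3, e4]
      ext i
      simp
      field_simp
      simp
    have e6 : ketEquiv d (O *ᵥ t.1) = (tracelessProj d (O *ᵥ t.1), 0) := by
      have : ∑ i : Fin d, (O *ᵥ t.1) (i, i) = 0 := by
        rw [hsum, dotProduct_mulVec, h2, zero_dotProduct]
      simp [ketEquiv, this]
    rw [LinearMap.comp_apply, LinearMap.comp_apply, LinearEquiv.coe_coe, LinearEquiv.coe_coe,
      toLin'_apply, e5, map_add, e6, LinearEquiv.apply_symm_apply]
    simp
  rw [h, LinearMap.det_prodMap, LinearMap.det_id, mul_one]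

namespace Measurement

variable {Ω : Type*} [MeasurableSpace Ω] {M : Measurement d Ω}

/-- Multiplying the completed error matrix by the frame gives a rank-two perturbation of the
identity, and `det(1 + PQ) = det(1 + QP)` reduces it to a `2 × 2` determinant. -/
theorem IsIC.barDet_optMSEMatrix [NeZero d] (hM : M.IsIC) {σ : Op d} (hσ : IsFullRankState σ) :
    barDet (M.optMSEMatrix σ) = d * ((M.frame σ).det)⁻¹ := by
  have hd : (d : ℂ) ≠ 0 := by exact_mod_cast NeZero.ne d
  have hF := hM.isUnit_det_frame hσ
  have h1 := hM.frame_inv_mulVec_one hσ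
  have hC := hM.optMSEMatrix_eq hσ
  have hH : (M.optMSEMatrix σ)ᴴ = M.optMSEMatrix σ := by
    rw [hC, conjTranspose_sub, (M.frame_isHermitian σ).inv.eq]
    simp [ketBra, conjTranspose_vecMulVec]
  have hk : M.optMSEMatrix σ *ᵥ (1 : Op d).vec = 0 := by
    rw [hC, Matrix.sub_mulVec, h1, ketBra, vecMulVec_mulVec, star_vec_dotProduct_one, hσ.2]
    simp
  rw [barDet_eq_det _ hk (by rw [← hH, ← star_mulVec, hk, star_zero]), hC]
  refine (eq_mul_inv_iff_mul_eq₀ hF.ne_zero).mpr ?_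
  rw [mul_comm, ← det_mul]
  set e := (1 : Op d).vec
  let P : Matrix (Fin d × Fin d) (Fin 2) ℂ :=
    Matrix.of fun i k => ![-e i, (d : ℂ)⁻¹ * (M.frame σ *ᵥ e) i] k
  let Q : Matrix (Fin 2) (Fin d × Fin d) ℂ := Matrix.of ![star σ.vec, star e]
  have hPQ : M.frame σ * ((M.frame σ)⁻¹ - ketBra σ σ + (d : ℂ)⁻¹ • ketBra (1 : Op d) 1) =
      1 + P * Q := by
    rw [Matrix.mul_add, Matrix.mul_sub, Matrix.mul_nonsing_inv _ hF, ketBra, Matrix.mul_vecMulVec,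
      M.frame_mulVec_state hσ, Matrix.mul_smul, ketBra, Matrix.mul_vecMulVec]
    ext i j
    simp [P, Q, Matrix.mul_apply, vecMulVec_apply, e]
    ring
  have a1 : star σ.vec ⬝ᵥ e = 1 := by rw [star_vec_dotProduct_one, hσ.2, star_one]
  have a2 : star e ⬝ᵥ e = d := by rw [star_one_vec_dotProduct]; simp
  have a3 : star σ.vec ⬝ᵥ (M.frame σ *ᵥ e) = d := by
    rw [dotProduct_mulVec, ← (M.frame_isHermitian σ).eq, ← star_mulVec, M.frame_mulVec_state hσ,
      a2]
  have hQP : Q * P = !![-1, 1; -(d : ℂ), (d : ℂ)⁻¹ * (star e ⬝ᵥ (M.frame σ *ᵥ e))] := by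
    have b1 : P.col 0 = -e := rfl
    have b2 : P.col 1 = (d : ℂ)⁻¹ • (M.frame σ *ᵥ e) := rfl
    have b3 : ∀ i j, (Q * P) i j = Q.row i ⬝ᵥ P.col j := fun _ _ => rfl
    have b4 : Q.row 0 = star σ.vec := rfl
    have b5 : Q.row 1 = star e := rfl
    ext i j
    fin_cases i <;> fin_cases j <;>
      simp [b3, b1, b2, b4, b5, a1, a2, a3, hd]
  -- The upper left entry of `1 + QP` is `0`, so the only entry without a known value drops out.
  rw [hPQ, det_one_add_mul_comm, hQP, Matrix.det_fin_two]
  simp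

theorem unitBallVol_pos [NeZero d] : 0 < unitBallVol d := by
  unfold unitBallVol
  have : 0 < Real.Gamma (((d : ℝ) ^ 2 + 1) / 2) := Real.Gamma_pos_of_pos (by positivity)
  have := Real.pi_pos
  positivity

theorem IsIC.log_volume [NeZero d] (hM : M.IsIC) {σ : Op d} (hσ : IsFullRankState σ) :
    Real.log (M.volume σ) =
      Real.log (unitBallVol d) + (Real.log d - Real.log (M.frame σ).det.re) / 2 := by
  have hdet := Complex.lt_def.mp (hM.posDef_frame hσ).det_pos
  have hd : (0 : ℝ) < d := by exact_mod_cast Nat.pos_of_ne_zero (NeZero.ne d)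
  have h0 : 0 < (M.frame σ).det.re := hdet.1
  have h1 : (M.frame σ).det = ((M.frame σ).det.re : ℂ) := Complex.ext rfl hdet.2.symm
  have h2 : (barDet (M.optMSEMatrix σ)).re = d * ((M.frame σ).det.re)⁻¹ := by
    rw [hM.barDet_optMSEMatrix hσ, h1, ← Complex.ofReal_inv, ← Complex.ofReal_natCast,
      ← Complex.ofReal_mul, Complex.ofReal_re, Complex.ofReal_re]
  rw [volume, h2, Real.log_mul unitBallVol_pos.ne' (by positivity), Real.log_sqrt (by positivity),
    Real.log_mul hd.ne' (by positivity), Real.log_inv]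
  ring

end Measurement

/-! ### Matrix inequalities -/

/-- The tangent at `G` of the convex function `A ↦ Tr(W A⁻¹)`; it is `Tr(W (A⁻¹ - G⁻¹) A (A⁻¹ -
G⁻¹)) ≥ 0` multiplied out. -/
theorem inv_tangent_le {n : Type*} [Fintype n] [DecidableEq n] {A G W : Matrix n n ℂ}
    (hA : A.PosDef) (hG : G.PosDef) (hW : W.PosSemidef) :
    2 * (W * G⁻¹).trace.re - (G⁻¹ * W * G⁻¹ * A).trace.re ≤ (W * A⁻¹).trace.re := by
  have hA' := (Matrix.isUnit_iff_isUnit_det _).mp hA.isUnit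
  have hG' := (Matrix.isUnit_iff_isUnit_det _).mp hG.isUnit
  have h1 := hA.posSemidef.conjTranspose_mul_mul_same (A⁻¹ - G⁻¹)
  rw [(hA.isHermitian.inv.sub hG.isHermitian.inv).eq] at h1
  have h2 : (A⁻¹ - G⁻¹) * A * (A⁻¹ - G⁻¹) = A⁻¹ - G⁻¹ - G⁻¹ + G⁻¹ * A * G⁻¹ := by
    rw [Matrix.sub_mul, Matrix.nonsing_inv_mul _ hA', Matrix.sub_mul, Matrix.mul_sub (G⁻¹ * A),
      Matrix.mul_assoc G⁻¹ A A⁻¹, Matrix.mul_nonsing_inv _ hA', Matrix.one_mul, Matrix.mul_one]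
    abel
  have h3 := (Complex.le_def.mp (trace_mul_nonneg hW h1)).1
  have h4 : (W * (G⁻¹ * A * G⁻¹)).trace = (G⁻¹ * W * G⁻¹ * A).trace := by
    rw [← Matrix.mul_assoc, Matrix.trace_mul_comm]
    simp only [Matrix.mul_assoc]
  rw [h2, Matrix.mul_add, Matrix.mul_sub, Matrix.mul_sub, Matrix.trace_add, h4] at h3
  simp at h3
  linarith

/-- The tangent at `G` of the concave function `log det`. With `G⁻¹ = B† B` it reduces to `log x ≤ x
- 1` at the eigenvalues of `B A B†`. -/
theorem log_det_le {n : Type*} [Fintype n] [DecidableEq n] {A G : Matrix n n ℂ}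
    (hA : A.PosDef) (hG : G.PosDef) :
    Real.log A.det.re ≤ Real.log G.det.re + (G⁻¹ * A).trace.re - Fintype.card n := by
  obtain ⟨B, hB⟩ := exists_eq_conjTranspose_mul_self hG.inv.posSemidef
  have hG' := (Matrix.isUnit_iff_isUnit_det _).mp hG.isUnit
  have hBu : IsUnit B := by
    refine (Matrix.isUnit_iff_isUnit_det _).mpr (isUnit_iff_ne_zero.mpr fun h0 => ?_)
    have := congrArg Matrix.det hB
    rw [det_mul, h0, mul_zero] at this
    exact hG.inv.det_pos.ne' this
  have hC : (B * A * Bᴴ).PosDef :=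
    hA.mul_mul_conjTranspose_same (Matrix.vecMul_injective_of_isUnit hBu)
  have h1 : (B * A * Bᴴ).trace = (G⁻¹ * A).trace := by
    rw [Matrix.trace_mul_comm, ← Matrix.mul_assoc, hB]
  have h2 : (B * A * Bᴴ).det = A.det * G.det⁻¹ := by
    have h3 : (Bᴴ * B).det = G.det⁻¹ := by rw [← hB, det_nonsing_inv, Ring.inverse_eq_inv']
    rw [det_mul] at h3
    rw [det_mul, det_mul, ← h3]
    ring
  have hAd := Complex.lt_def.mp hA.det_pos
  have hGd := Complex.lt_def.mp hG.det_pos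
  have eA : A.det = (A.det.re : ℂ) := Complex.ext rfl hAd.2.symm
  have eG : G.det = (G.det.re : ℂ) := Complex.ext rfl hGd.2.symm
  have h4 : ∏ i, hC.isHermitian.eigenvalues i = A.det.re * G.det.re⁻¹ := by
    have h5 := hC.isHermitian.det_eq_prod_eigenvalues
    rw [h2, eA, eG] at h5
    have h6 : ((A.det.re * G.det.re⁻¹ : ℝ) : ℂ) =
        ((∏ i, hC.isHermitian.eigenvalues i : ℝ) : ℂ) := by
      push_cast
      exact h5
    exact (Complex.ofReal_injective h6).symm
  have h7 : (G⁻¹ * A).trace.re = ∑ i, hC.isHermitian.eigenvalues i := by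
    rw [← h1, hC.isHermitian.trace_eq_sum_eigenvalues]
    simp
  have h8 : Real.log A.det.re - Real.log G.det.re =
      ∑ i, Real.log (hC.isHermitian.eigenvalues i) := by
    rw [← Real.log_prod fun i _ => (hC.eigenvalues_pos i).ne', h4,
      Real.log_mul hAd.1.ne' (inv_ne_zero hGd.1.ne'), Real.log_inv]
    ring
  have h9 : ∑ i, Real.log (hC.isHermitian.eigenvalues i) ≤
      ∑ i, (hC.isHermitian.eigenvalues i - 1) :=
    Finset.sum_le_sum fun i _ => Real.log_le_sub_one_of_pos (hC.eigenvalues_pos i)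
  rw [Finset.sum_sub_distrib] at h9
  simp at h9
  linarith

/-- The difference is positive semidefinite with zero form, and a null vector of a positive
semidefinite form lies in the kernel. -/
theorem IsHermitian.eq_of_forall_dotProduct {n : Type*} [Fintype n]
    {A B : Matrix n n ℂ} (hA : A.IsHermitian) (hB : B.IsHermitian)
    (h : ∀ x, star x ⬝ᵥ (A *ᵥ x) = star x ⬝ᵥ (B *ᵥ x)) : A = B := by
  have h0 : ∀ x, star x ⬝ᵥ ((A - B) *ᵥ x) = 0 := fun x => by
    rw [Matrix.sub_mulVec, dotProduct_sub, h, sub_self]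
  have hp : (A - B).PosSemidef :=
    PosSemidef.of_dotProduct_mulVec_nonneg (hA.sub hB) fun x => (h0 x).ge
  have h1 : ∀ x, (A - B) *ᵥ x = 0 := fun x => (hp.dotProduct_mulVec_zero_iff x).mp (h0 x)
  classical
  refine sub_eq_zero.mp (Matrix.ext_of_mulVec_single fun i => ?_)
  rw [h1, Matrix.zero_mulVec]

/-! ### Conjugation as a superoperator -/

/-- The superoperator `A ↦ V A V†`. -/
def conjSuperOp (V : U d) : SuperOp d := (V : Op d).map star ⊗ₖ (V : Op d)

theorem conjSuperOp_mulVec (V : U d) (A : Op d) : conjSuperOp V *ᵥ A.vec = (conj V A).vec := by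
  rw [conjSuperOp, kronecker_mulVec_vec]
  rfl

theorem conjSuperOp_conjTranspose (V : U d) : (conjSuperOp V)ᴴ = conjSuperOp V⁻¹ := by
  rw [conjSuperOp, conjTranspose_kronecker]
  rfl

theorem conjSuperOp_mul (V V' : U d) :
    conjSuperOp V * conjSuperOp V' = conjSuperOp (V * V') := by
  rw [conjSuperOp, conjSuperOp, ← mul_kronecker_mul, conjSuperOp]
  congr 1
  ext i j
  simp [Matrix.mul_apply]

theorem conjSuperOp_one : conjSuperOp (1 : U d) = 1 := by
  have : ((1 : U d) : Op d).map star = 1 := by simp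
  rw [conjSuperOp, this]
  simp

theorem conjSuperOp_mul_conjTranspose (V : U d) : conjSuperOp V * (conjSuperOp V)ᴴ = 1 := by
  rw [conjSuperOp_conjTranspose, conjSuperOp_mul, mul_inv_cancel, conjSuperOp_one]

theorem conjSuperOp_conjTranspose_mul (V : U d) : (conjSuperOp V)ᴴ * conjSuperOp V = 1 := by
  rw [conjSuperOp_conjTranspose, conjSuperOp_mul, inv_mul_cancel, conjSuperOp_one]

theorem continuous_conjSuperOp : Continuous fun V : U d => conjSuperOp V := by
  refine continuous_matrix fun i j => ?_
  have h : ∀ k l, Continuous fun V : U d => (V : Op d) k l := fun k l =>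
    continuous_subtype_val.matrix_elem k l
  exact (continuous_star.comp (h _ _)).mul (h _ _)

namespace Measurement

variable {Ω : Type*} [MeasurableSpace Ω] {M : Measurement d Ω}

/-- The frame superoperator at `V ρ V†`, transported back to `ρ`. -/
def orbitFrame (M : Measurement d Ω) (ρ : Op d) (V : U d) : SuperOp d :=
  (conjSuperOp V)ᴴ * M.frame (conj V ρ) * conjSuperOp V

theorem continuous_orbitFrame [NeZero d] {ρ : Op d} (hρ : IsFullRankState ρ) :
    Continuous fun V : U d => M.orbitFrame ρ V :=
  (continuous_conjSuperOp.matrix_conjTranspose.matrix_mul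
    (M.continuous_frame_conj hρ)).matrix_mul continuous_conjSuperOp

theorem orbitFrame_isHermitian (ρ : Op d) (V : U d) : (M.orbitFrame ρ V).IsHermitian :=
  isHermitian_conjTranspose_mul_mul _ (M.frame_isHermitian _)

theorem IsIC.posDef_orbitFrame [NeZero d] (hM : M.IsIC) {ρ : Op d} (hρ : IsFullRankState ρ)
    (V : U d) : (M.orbitFrame ρ V).PosDef :=
  (hM.posDef_frame (hρ.conj V)).conjTranspose_mul_mul_same
    (Matrix.mulVec_injective_of_isUnit (IsUnit.of_mul_eq_one _ (conjSuperOp_mul_conjTranspose V)))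

theorem det_orbitFrame (ρ : Op d) (V : U d) :
    (M.orbitFrame ρ V).det = (M.frame (conj V ρ)).det := by
  have h := congrArg Matrix.det (conjSuperOp_conjTranspose_mul V)
  rw [det_mul, det_one] at h
  rw [orbitFrame, det_mul, det_mul, mul_right_comm, h, one_mul]

theorem orbitFrame_inv (ρ : Op d) (V : U d) :
    (M.orbitFrame ρ V)⁻¹ = (conjSuperOp V)ᴴ * (M.frame (conj V ρ))⁻¹ * conjSuperOp V := by
  rw [orbitFrame, Matrix.mul_inv_rev, Matrix.mul_inv_rev,
    Matrix.inv_eq_right_inv (conjSuperOp_mul_conjTranspose V),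
    Matrix.inv_eq_right_inv (conjSuperOp_conjTranspose_mul V), Matrix.mul_assoc]

end Measurement

/-! ### Haar averages -/

theorem integrable_haarU {f : U d → ℝ} (hf : Continuous f) : Integrable f (haarU d) :=
  hf.integrable_of_hasCompactSupport (HasCompactSupport.of_compactSpace _)

/-- Integrate `f(x⁻¹ y)` in both orders: left invariance in `y` gives one side, left invariance in
`x` the other. -/
theorem integral_haarU_inv {f : U d → ℝ} (hf : Continuous f) :
    ∫ V, f V⁻¹ ∂haarU d = ∫ V, f V ∂haarU d := by
  have hc : Continuous (Function.uncurry fun x y : U d => f (x⁻¹ * y)) :=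
    hf.comp (continuous_fst.inv.mul continuous_snd)
  have hi : Integrable (Function.uncurry fun x y : U d => f (x⁻¹ * y))
      ((haarU d).prod (haarU d)) :=
    hc.integrable_of_hasCompactSupport (HasCompactSupport.of_compactSpace _)
  have h := integral_integral_swap hi
  have h1 : ∀ x : U d, ∫ y, f (x⁻¹ * y) ∂haarU d = ∫ y, f y ∂haarU d := fun x =>
    integral_mul_left_eq_self f x⁻¹
  have h2 : ∀ y : U d, ∫ x, f (x⁻¹ * y) ∂haarU d = ∫ x, f x⁻¹ ∂haarU d := fun y => by
    rw [← integral_mul_left_eq_self (fun x => f x⁻¹) y⁻¹]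
    simp
  simp_rw [h1, h2] at h
  simpa using h.symm

/-- The weight of the outcome operator `A` in the quadratic form `⟨⟨X|F(ρ)|X⟩⟩` of the frame
superoperator, at the operators `V ρ V†` and `V X V†`. -/
def orbitForm (ρ X A : Op d) (V : U d) : ℝ :=
  ((A * conj V ρ).trace.re)⁻¹ * ‖(A * conj V X).trace‖ ^ 2

theorem orbitForm_conj (ρ X A : Op d) (V V' : U d) :
    orbitForm ρ X (conj V' A) V = orbitForm ρ X A (V'⁻¹ * V) := by
  simp [orbitForm, trace_conj_mul, conj_mul]

theorem continuous_trace_mul_conj (A X : Op d) :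
    Continuous fun V : U d => (A * conj V X).trace :=
  (continuous_const.matrix_mul (continuous_conj X)).matrix_trace

theorem continuous_orbitForm [NeZero d] {ρ : Op d} (hρ : IsFullRankState ρ) (X : Op d) {A : Op d}
    (hA : A.PosSemidef) : Continuous (orbitForm ρ X A) := by
  by_cases hA0 : A = 0
  · have : orbitForm ρ X A = fun _ => 0 := by
      funext V
      simp [hA0, orbitForm]
    rw [this]
    exact continuous_const
  have h1 : Continuous fun V : U d => (A * conj V ρ).trace.re :=
    Complex.continuous_re.comp (continuous_trace_mul_conj A ρ)
  exact (h1.inv₀ fun V => (trace_mul_conj_pos hρ hA hA0 V).ne').mul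
    ((continuous_trace_mul_conj A X).norm.pow 2)

theorem posSemidef_single [NeZero d] : (Matrix.single 0 0 1 : Op d).PosSemidef := by
  rw [← Matrix.diagonal_single]
  exact PosSemidef.diagonal (Pi.single_nonneg.mpr zero_le_one)

theorem single_ne_zero' [NeZero d] : (Matrix.single 0 0 1 : Op d) ≠ 0 := by
  intro h
  have := congrFun (congrFun h 0) 0
  simp at this

theorem orbitForm_nonneg {ρ : Op d} (hρ : IsFullRankState ρ) (X : Op d) {A : Op d}
    (hA : A.PosSemidef) (V : U d) : 0 ≤ orbitForm ρ X A V :=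
  mul_nonneg (inv_nonneg.mpr (Complex.le_def.mp
    (trace_mul_nonneg hA (hρ.conj V).1.posSemidef)).1) (by positivity)

/-- Averaged over the unitary group, pure outcomes of the same trace are the best ones. -/
theorem integral_orbitForm_le [NeZero d] {ρ : Op d} (hρ : IsFullRankState ρ) (X : Op d) {A : Op d}
    (hA : A.PosSemidef) :
    ∫ V, orbitForm ρ X A V ∂haarU d ≤
      A.trace.re * ∫ V, orbitForm ρ X (Matrix.single 0 0 1) V ∂haarU d := by
  obtain ⟨W, hW⟩ := exists_sum_conj_single hA.isHermitian
  set l := hA.isHermitian.eigenvalues with hl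
  have hl0 : ∀ k, 0 ≤ l k := hA.eigenvalues_nonneg
  have hP : ∀ k, (conj (W k) (Matrix.single 0 0 1)).PosSemidef := fun k =>
    posSemidef_conj _ posSemidef_single
  have hq : ∀ k V, 0 < (conj (W k) (Matrix.single 0 0 1) * conj V ρ).trace.re := fun k V => by
    rw [trace_conj_mul, ← conj_mul]
    exact trace_mul_conj_pos hρ posSemidef_single single_ne_zero' _
  have hpt : ∀ V, orbitForm ρ X A V ≤
      ∑ k, l k * orbitForm ρ X (conj (W k) (Matrix.single 0 0 1)) V := by
    intro V
    have e1 : (A * conj V ρ).trace.re =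
        ∑ k, l k * (conj (W k) (Matrix.single 0 0 1) * conj V ρ).trace.re := by
      conv_lhs => rw [hW]
      simp [Finset.sum_mul, Matrix.trace_sum]
    have e2 : ‖(A * conj V X).trace‖ ≤
        ∑ k, l k * ‖(conj (W k) (Matrix.single 0 0 1) * conj V X).trace‖ := by
      conv_lhs => rw [hW]
      rw [Finset.sum_mul, Matrix.trace_sum]
      refine (norm_sum_le _ _).trans (Finset.sum_le_sum fun k _ => ?_)
      rw [Matrix.smul_mul, Matrix.trace_smul, norm_smul, Complex.norm_real, Real.norm_eq_abs,
        abs_of_nonneg (hl0 k)]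
    -- Cauchy-Schwarz in the form `(∑ l r)² ≤ (∑ l q)(∑ l r² / q)`.
    have e3 := Finset.sum_sq_le_sum_mul_sum_of_sq_le_mul Finset.univ
      (r := fun k => l k * ‖(conj (W k) (Matrix.single 0 0 1) * conj V X).trace‖)
      (f := fun k => l k * (conj (W k) (Matrix.single 0 0 1) * conj V ρ).trace.re)
      (g := fun k => l k * orbitForm ρ X (conj (W k) (Matrix.single 0 0 1)) V)
      (fun k _ => mul_nonneg (hl0 k) (hq k V).le)
      (fun k _ => mul_nonneg (hl0 k) (orbitForm_nonneg hρ X (hP k) V))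
      (fun k _ => le_of_eq (by
        have := (hq k V).ne'
        simp only [orbitForm]
        field_simp))
    rw [← e1] at e3
    have e4 := (pow_le_pow_left₀ (norm_nonneg _) e2 2).trans e3
    have hp : 0 ≤ (A * conj V ρ).trace.re :=
      (Complex.le_def.mp (trace_mul_nonneg hA (hρ.conj V).1.posSemidef)).1
    rcases hp.eq_or_lt with h0 | h0
    · rw [orbitForm, ← h0, _root_.inv_zero, zero_mul]
      exact Finset.sum_nonneg fun k _ => mul_nonneg (hl0 k) (orbitForm_nonneg hρ X (hP k) V)
    · rw [orbitForm, inv_mul_le_iff₀ h0]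
      exact e4
  have hint : ∀ k, Integrable
      (fun V => l k * orbitForm ρ X (conj (W k) (Matrix.single 0 0 1)) V) (haarU d) := fun k =>
    (integrable_haarU (continuous_orbitForm hρ X (hP k))).const_mul _
  refine (integral_mono (integrable_haarU (continuous_orbitForm hρ X hA))
    (integrable_finsetSum _ fun k _ => hint k) hpt).trans (le_of_eq ?_)
  rw [integral_finsetSum _ fun k _ => hint k, trace_eq_sum_eigenvalues hA.isHermitian,
    Finset.sum_mul]
  refine Finset.sum_congr rfl fun k _ => ?_
  rw [integral_const_mul]
  congr 1
  -- Rotating the outcome translates the argument, so every pure outcome has the Haar average of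
  -- `|0⟩⟨0|`.
  simp_rw [orbitForm_conj]
  exact integral_mul_left_eq_self _ _

/-- The entries of `V X V†` are bounded uniformly in `V` because `U(d)` is compact. -/
theorem exists_norm_trace_mul_conj_le (X : Op d) :
    ∃ m : ℝ, ∀ (V : U d) (A : Op d), A.PosSemidef →
      ‖(A * conj V X).trace‖ ≤ m * A.trace.re := by
  have hc : Continuous fun V : U d => ∑ i, ∑ j, ‖conj V X j i‖ :=
    continuous_finsetSum _ fun i _ => continuous_finsetSum _ fun j _ =>
      ((continuous_conj X).matrix_elem j i).norm
  obtain ⟨m, hm⟩ := (isCompact_range hc).bddAbove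
  refine ⟨m, fun V A hA => ?_⟩
  have h0 : 0 ≤ A.trace.re := (Complex.le_def.mp hA.trace_nonneg).1
  calc ‖(A * conj V X).trace‖ ≤ ∑ i, ∑ j, ‖A i j‖ * ‖conj V X j i‖ := by
        simp only [Matrix.trace, Matrix.diag, Matrix.mul_apply]
        refine (norm_sum_le _ _).trans (Finset.sum_le_sum fun i _ => ?_)
        refine (norm_sum_le _ _).trans (Finset.sum_le_sum fun j _ => ?_)
        rw [norm_mul]
    _ ≤ ∑ i, ∑ j, A.trace.re * ‖conj V X j i‖ := by
        gcongr with i _ j _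
        exact norm_apply_le_trace hA i j
    _ = (∑ i, ∑ j, ‖conj V X j i‖) * A.trace.re := by
        simp_rw [← Finset.mul_sum]
        rw [mul_comm]
    _ ≤ m * A.trace.re := by
        gcongr
        exact hm ⟨V, rfl⟩

theorem exists_orbitForm_le [NeZero d] {ρ : Op d} (hρ : IsFullRankState ρ) (X : Op d) :
    ∃ C : ℝ, ∀ (V : U d) (A : Op d), A.PosSemidef → orbitForm ρ X A V ≤ C * A.trace.re := by
  obtain ⟨c, hc, h⟩ := exists_orbit_lower_bound hρ
  obtain ⟨m, hm⟩ := exists_norm_trace_mul_conj_le X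
  refine ⟨c⁻¹ * m ^ 2, fun V A hA => ?_⟩
  have h0 : 0 ≤ A.trace.re := (Complex.le_def.mp hA.trace_nonneg).1
  rcases h0.eq_or_lt with h1 | h1
  · have : A = 0 := hA.trace_eq_zero_iff.mp
      (Complex.ext h1.symm (Complex.le_def.mp hA.trace_nonneg).2.symm)
    simp [this, orbitForm]
  · calc orbitForm ρ X A V ≤ (c * A.trace.re)⁻¹ * (m * A.trace.re) ^ 2 := by
          unfold orbitForm
          gcongr
          · exact h V A hA
          · exact hm V A hA
      _ = c⁻¹ * m ^ 2 * A.trace.re := by field_simp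

namespace Measurement

variable {Ω : Type*} [MeasurableSpace Ω] {M : Measurement d Ω}

theorem orbitFrame_form [NeZero d] (M : Measurement d Ω) {ρ : Op d} (hρ : IsFullRankState ρ)
    (V : U d) (X : Op d) :
    star X.vec ⬝ᵥ (M.orbitFrame ρ V *ᵥ X.vec) =
      ((∫ ξ, orbitForm ρ X (M.op ξ) V ∂M.ref : ℝ) : ℂ) := by
  rw [orbitFrame, ← Matrix.mulVec_mulVec, ← Matrix.mulVec_mulVec, dotProduct_mulVec,
    ← star_mulVec, conjSuperOp_mulVec]
  exact (M.star_dotProduct_frame_mulVec (hρ.conj V) (conj V X)).1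

theorem aestronglyMeasurable_trace_mul_conj {μ : Measure Ω} [SFinite μ]
    (h : ∀ i j, AEStronglyMeasurable (fun ξ => M.op ξ i j) μ) (X : Op d) :
    AEStronglyMeasurable (fun p : U d × Ω => (M.op p.2 * conj p.1 X).trace)
      ((haarU d).prod μ) := by
  simp only [Matrix.trace, Matrix.diag, Matrix.mul_apply]
  refine Finset.aestronglyMeasurable_fun_sum _ fun i _ =>
    Finset.aestronglyMeasurable_fun_sum _ fun j _ => ?_
  refine AEStronglyMeasurable.mul ?_ ?_
  · exact (h i j).comp_snd
  · exact (((continuous_conj X).matrix_elem j i).aestronglyMeasurable (μ := haarU d)).comp_fst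

/-- Averaged over the orbit, the quadratic form of the frame superoperator is at most that of the
covariant measurement. -/
theorem integral_orbitFrame_form_le [NeZero d] (M : Measurement d Ω) {ρ : Op d}
    (hρ : IsFullRankState ρ) (X : Op d) :
    ∫ V, (star X.vec ⬝ᵥ (M.orbitFrame ρ V *ᵥ X.vec)).re ∂haarU d ≤
      d * ∫ V, orbitForm ρ X (Matrix.single 0 0 1) V ∂haarU d := by
  simp_rw [M.orbitFrame_form hρ, Complex.ofReal_re]
  obtain ⟨C, hC⟩ := exists_orbitForm_le hρ X
  -- The reference measure need not be σ-finite. Integrability of `tr Π_ξ` yields a σ-finite part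
  -- outside which `Π_ξ = 0` almost everywhere, and Fubini is applied there.
  obtain ⟨t, ht, hzero, hsig⟩ := M.integrable_trace_re.aefinStronglyMeasurable.exists_set_sigmaFinite
  have hop : ∀ᵐ ξ ∂M.ref, ξ ∉ t → M.op ξ = 0 := by
    have := (ae_restrict_iff' ht.compl).mp hzero
    filter_upwards [this] with ξ hξ hnt
    exact (M.posSemidef ξ).trace_eq_zero_iff.mp (Complex.ext (hξ hnt)
      (Complex.le_def.mp (M.posSemidef ξ).trace_nonneg).2.symm)
  have hrestrict : ∀ f : Op d → ℝ, f 0 = 0 →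
      ∫ ξ, f (M.op ξ) ∂M.ref = ∫ ξ in t, f (M.op ξ) ∂M.ref := by
    intro f hf
    refine (setIntegral_eq_integral_of_ae_compl_eq_zero ?_).symm
    filter_upwards [hop] with ξ hξ hnt
    rw [hξ hnt, hf]
  have h1 : ∀ V, ∫ ξ, orbitForm ρ X (M.op ξ) V ∂M.ref =
      ∫ ξ in t, orbitForm ρ X (M.op ξ) V ∂M.ref := fun V =>
    hrestrict (fun A => orbitForm ρ X A V) (by simp [orbitForm])
  have hint : Integrable (fun ξ => (M.op ξ).trace.re) (M.ref.restrict t) :=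
    M.integrable_trace_re.restrict
  have hmeas : ∀ i j, AEStronglyMeasurable (fun ξ => M.op ξ i j) (M.ref.restrict t) :=
    fun i j => (M.integrable i j).aestronglyMeasurable.restrict
  have hprod : Integrable (Function.uncurry fun (V : U d) ξ => orbitForm ρ X (M.op ξ) V)
      ((haarU d).prod (M.ref.restrict t)) := by
    refine ((hint.comp_snd (haarU d)).const_mul C).mono' ?_
      (Filter.Eventually.of_forall fun p => ?_)
    · have m1 := aestronglyMeasurable_trace_mul_conj hmeas ρ
      have m2 := aestronglyMeasurable_trace_mul_conj hmeas X
      exact (Complex.measurable_re.comp_aemeasurable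
        m1.aemeasurable).inv.aestronglyMeasurable.mul (m2.norm.pow 2)
    · simp only [Function.uncurry]
      rw [Real.norm_eq_abs, abs_of_nonneg (orbitForm_nonneg hρ X (M.posSemidef _) _)]
      exact hC _ _ (M.posSemidef _)
  simp_rw [h1]
  rw [integral_integral_swap hprod]
  calc ∫ ξ in t, ∫ V, orbitForm ρ X (M.op ξ) V ∂haarU d ∂M.ref
      ≤ ∫ ξ in t, (M.op ξ).trace.re * (∫ V, orbitForm ρ X (Matrix.single 0 0 1) V ∂haarU d)
          ∂M.ref :=
        integral_mono hprod.integral_prod_right (hint.mul_const _)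
          fun ξ => integral_orbitForm_le hρ X (M.posSemidef ξ)
    _ = _ := by
        rw [integral_mul_const, ← hrestrict (fun A => A.trace.re) (by simp), M.integral_trace_re]

end Measurement

/-! ### The covariant measurement -/

theorem integral_haarPure [NeZero d] {f : PureState d → ℝ}
    (hf : AEStronglyMeasurable f (haarPure d)) :
    ∫ P, f P ∂haarPure d = ∫ V, f (pureOrbit d V) ∂haarU d :=
  integral_map (continuous_pureOrbit d).measurable.aemeasurable hf

/-- Integrating over pure outcomes is already a Haar average, so the value at each single `V` equals
the upper bound for orbit averages. -/
theorem covariant_orbitFrame_form [NeZero d] {ρ : Op d} (hρ : IsFullRankState ρ) (V : U d)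
    (X : Op d) :
    star X.vec ⬝ᵥ ((covariant d).orbitFrame ρ V *ᵥ X.vec) =
      ((d * ∫ V, orbitForm ρ X (Matrix.single 0 0 1) V ∂haarU d : ℝ) : ℂ) := by
  rw [(covariant d).orbitFrame_form hρ]
  congr 1
  have hd : (d : ℝ) ≠ 0 := by exact_mod_cast NeZero.ne d
  have hm : AEStronglyMeasurable (fun P => orbitForm ρ X ((covariant d).op P) V) (haarPure d) :=
    ((covariant d).star_dotProduct_frame_mulVec (hρ.conj V) (conj V X)).2.aestronglyMeasurable
  rw [show (covariant d).ref = haarPure d from rfl, integral_haarPure hm]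
  have h1 : ∀ V', orbitForm ρ X ((covariant d).op (pureOrbit d V')) V =
      d * orbitForm ρ X (Matrix.single 0 0 1) (V'⁻¹ * V) := by
    intro V'
    rw [← orbitForm_conj]
    change orbitForm ρ X ((d : ℂ) • conj V' (Matrix.single 0 0 1)) V = _
    -- The form is homogeneous of degree one in the outcome: `d² / d = d`.
    simp only [orbitForm, Matrix.smul_mul, Matrix.trace_smul, smul_eq_mul, norm_mul,
      Complex.norm_natCast]
    rw [← Complex.ofReal_natCast, Complex.re_ofReal_mul, mul_inv]
    field_simp
  simp_rw [h1]
  rw [integral_const_mul]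
  congr 1
  rw [← integral_haarU_inv (continuous_orbitForm hρ X posSemidef_single),
    ← integral_mul_left_eq_self (fun W => orbitForm ρ X (Matrix.single 0 0 1) W⁻¹) V⁻¹]
  simp

theorem covariant_orbitFrame [NeZero d] {ρ : Op d} (hρ : IsFullRankState ρ) (V : U d) :
    (covariant d).orbitFrame ρ V = (covariant d).frame ρ := by
  have h1 : (covariant d).frame ρ = (covariant d).orbitFrame ρ 1 := by
    simp [Measurement.orbitFrame, conjSuperOp_one, conj_one]
  rw [h1]
  refine IsHermitian.eq_of_forall_dotProduct (Measurement.orbitFrame_isHermitian _ _)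
    (Measurement.orbitFrame_isHermitian _ _) fun x => ?_
  obtain ⟨X, rfl⟩ := vec_bijective.surjective x
  rw [covariant_orbitFrame_form hρ, covariant_orbitFrame_form hρ]

/-- By continuity, equality of the statistics for almost every pure state holds for all. The
eigenprojectors of `ρ - σ` are among them, so `tr (ρ - σ)² = 0`. -/
theorem covariant_isIC [NeZero d] : (covariant d).IsIC := by
  intro ρ σ hρ hσ h
  have hX : (ρ - σ).IsHermitian := hρ.1.isHermitian.sub hσ.1.isHermitian
  have hd : (d : ℝ) ≠ 0 := by exact_mod_cast NeZero.ne d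
  have h1 : ∀ᵐ V ∂haarU d, (conj V (Matrix.single 0 0 1) * (ρ - σ)).trace.re = 0 := by
    have h2 := ae_of_ae_map (continuous_pureOrbit d).measurable.aemeasurable h
    filter_upwards [h2] with V hV
    change ((d : ℂ) • conj V (Matrix.single 0 0 1) * ρ).trace.re =
      ((d : ℂ) • conj V (Matrix.single 0 0 1) * σ).trace.re at hV
    rw [Matrix.smul_mul, Matrix.smul_mul, Matrix.trace_smul, Matrix.trace_smul, smul_eq_mul,
      smul_eq_mul, ← Complex.ofReal_natCast, Complex.re_ofReal_mul, Complex.re_ofReal_mul] at hV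
    rw [Matrix.mul_sub, Matrix.trace_sub, Complex.sub_re, mul_left_cancel₀ hd hV, sub_self]
  have hc : Continuous fun V : U d => (conj V (Matrix.single 0 0 1) * (ρ - σ)).trace.re :=
    Complex.continuous_re.comp ((continuous_conj _).matrix_mul continuous_const).matrix_trace
  have h3 : ∀ V : U d, (conj V (Matrix.single 0 0 1) * (ρ - σ)).trace.re = 0 := fun V =>
    congrFun ((hc.ae_eq_iff_eq (haarU d) continuous_const).mp h1) V
  obtain ⟨W, hW⟩ := exists_sum_conj_single hX
  have h4 : ((ρ - σ)ᴴ * (ρ - σ)).trace = 0 := by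
    rw [hX.eq]
    conv_lhs =>
      enter [1, 1]
      rw [hW]
    rw [Finset.sum_mul, Matrix.trace_sum]
    refine Finset.sum_eq_zero fun k _ => ?_
    rw [Matrix.smul_mul, Matrix.trace_smul,
      trace_mul_eq_re (posSemidef_conj _ posSemidef_single).isHermitian hX, h3]
    simp
  exact sub_eq_zero.mp (trace_conjTranspose_mul_self_eq_zero_iff.mp h4)

/-! ### Optimality of the covariant measurement -/

namespace Measurement

variable {Ω : Type*} [MeasurableSpace Ω] {M : Measurement d Ω}

theorem continuous_trace_mul_orbitFrame [NeZero d] {ρ : Op d} (hρ : IsFullRankState ρ)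
    (S : SuperOp d) : Continuous fun V : U d => (S * M.orbitFrame ρ V).trace.re :=
  Complex.continuous_re.comp (continuous_const.matrix_mul (continuous_orbitFrame hρ)).matrix_trace

/-- The Loewner bound in dual form: writing `S = B† B` turns the trace into a sum of quadratic
forms, and the averaged superoperator need not be formed. -/
theorem integral_trace_mul_orbitFrame_le [NeZero d] (M : Measurement d Ω) {ρ : Op d}
    (hρ : IsFullRankState ρ) {S : SuperOp d} (hS : S.PosSemidef) :
    ∫ V, (S * M.orbitFrame ρ V).trace.re ∂haarU d ≤ (S * (covariant d).frame ρ).trace.re := by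
  obtain ⟨B, rfl⟩ := exists_eq_conjTranspose_mul_self hS
  choose X hX using fun i => vec_bijective.surjective (star (B i))
  have h1 : ∀ A : SuperOp d, (Bᴴ * B * A).trace.re =
      ∑ i, (star (X i).vec ⬝ᵥ (A *ᵥ (X i).vec)).re := by
    intro A
    rw [Matrix.mul_assoc, Matrix.trace_mul_comm, Matrix.trace, Complex.re_sum]
    refine Finset.sum_congr rfl fun i _ => ?_
    rw [hX, star_star, dotProduct_mulVec]
    rfl
  simp_rw [h1]
  have hc : ∀ i, Continuous fun V : U d =>
      (star (X i).vec ⬝ᵥ (M.orbitFrame ρ V *ᵥ (X i).vec)).re := fun i =>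
    Complex.continuous_re.comp (continuous_const.dotProduct
      ((continuous_orbitFrame hρ).matrix_mulVec continuous_const))
  rw [integral_finsetSum _ fun i _ => integrable_haarU (hc i)]
  refine Finset.sum_le_sum fun i _ => (M.integral_orbitFrame_form_le hρ (X i)).trans (le_of_eq ?_)
  rw [← covariant_orbitFrame hρ 1, covariant_orbitFrame_form hρ, Complex.ofReal_re]

theorem IsIC.continuous_trace_mul_orbitFrame_inv [NeZero d] (hM : M.IsIC) {ρ : Op d}
    (hρ : IsFullRankState ρ) (S : SuperOp d) :
    Continuous fun V : U d => (S * (M.orbitFrame ρ V)⁻¹).trace.re := by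
  have hc := continuous_orbitFrame (M := M) hρ
  have h : Continuous fun V : U d => (M.orbitFrame ρ V)⁻¹ := by
    simp only [Matrix.inv_def, Ring.inverse_eq_inv']
    exact (hc.matrix_det.inv₀ fun V => (hM.posDef_orbitFrame hρ V).det_pos.ne').smul
      hc.matrix_adjugate
  exact Complex.continuous_re.comp (continuous_const.matrix_mul h).matrix_trace

/-- Integrate the tangent at `G`. Its slope is `-S` with `S = G⁻¹ W G⁻¹ ≥ 0`, and `Tr(S G) = Tr(W
G⁻¹)` absorbs one of the two constant terms. -/
theorem IsIC.integral_trace_mul_inv_le [NeZero d] (hM : M.IsIC) {ρ : Op d}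
    (hρ : IsFullRankState ρ) {W : SuperOp d} (hW : W.PosSemidef) :
    (W * ((covariant d).frame ρ)⁻¹).trace.re ≤
      ∫ V, (W * (M.orbitFrame ρ V)⁻¹).trace.re ∂haarU d := by
  set G := (covariant d).frame ρ
  have hG : G.PosDef := covariant_isIC.posDef_frame hρ
  have hG' := (Matrix.isUnit_iff_isUnit_det _).mp hG.isUnit
  have hS : (G⁻¹ * W * G⁻¹).PosSemidef := by
    have := hW.mul_mul_conjTranspose_same G⁻¹
    rwa [hG.isHermitian.inv.eq] at this
  have h1 := M.integral_trace_mul_orbitFrame_le hρ hS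
  have h2 : (G⁻¹ * W * G⁻¹ * G).trace = (W * G⁻¹).trace := by
    rw [Matrix.mul_assoc, Matrix.nonsing_inv_mul _ hG', Matrix.mul_one, Matrix.trace_mul_comm]
  have hi := integrable_haarU (continuous_trace_mul_orbitFrame (M := M) hρ (G⁻¹ * W * G⁻¹))
  have h3 := integral_mono ((integrable_const (2 * (W * G⁻¹).trace.re)).sub hi)
    (integrable_haarU (hM.continuous_trace_mul_orbitFrame_inv hρ W))
    (fun V => inv_tangent_le (hM.posDef_orbitFrame hρ V) hG hW)
  rw [integral_sub' (integrable_const _) hi] at h3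
  simp only [integral_const, probReal_univ, one_smul] at h3
  change _ ≤ (G⁻¹ * W * G⁻¹ * G).trace.re at h1
  rw [h2] at h1
  linarith

theorem IsIC.integral_log_det_le [NeZero d] (hM : M.IsIC) {ρ : Op d} (hρ : IsFullRankState ρ) :
    Integrable (fun V => Real.log (M.orbitFrame ρ V).det.re) (haarU d) ∧
    ∫ V, Real.log (M.orbitFrame ρ V).det.re ∂haarU d ≤
      Real.log ((covariant d).frame ρ).det.re := by
  set G := (covariant d).frame ρ
  have hG : G.PosDef := covariant_isIC.posDef_frame hρ
  have hG' := (Matrix.isUnit_iff_isUnit_det _).mp hG.isUnit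
  have hint : Integrable (fun V => Real.log (M.orbitFrame ρ V).det.re) (haarU d) :=
    integrable_haarU ((Complex.continuous_re.comp (continuous_orbitFrame hρ).matrix_det).log
      fun V => (Complex.lt_def.mp (hM.posDef_orbitFrame hρ V).det_pos).1.ne')
  refine ⟨hint, ?_⟩
  have h1 := M.integral_trace_mul_orbitFrame_le hρ hG.inv.posSemidef
  change _ ≤ (G⁻¹ * G).trace.re at h1
  rw [Matrix.nonsing_inv_mul _ hG', Matrix.trace_one] at h1
  have hi := integrable_haarU (continuous_trace_mul_orbitFrame (M := M) hρ G⁻¹)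
  have h3 := integral_mono hint (((integrable_const (Real.log G.det.re)).add hi).sub
    (integrable_const (Fintype.card (Fin d × Fin d) : ℝ)))
    (fun V => log_det_le (hM.posDef_orbitFrame hρ V) hG)
  rw [integral_sub' ((integrable_const _).add hi) (integrable_const _),
    integral_add' (integrable_const _) hi] at h3
  simp only [integral_const, probReal_univ, one_smul] at h3
  rw [Complex.natCast_re] at h1
  linarith

end Measurement

theorem orbitAverageLE_log_volume [NeZero d] {Ω : Type*} [MeasurableSpace Ω]
    {M : Measurement d Ω} (hM : M.IsIC) {ρ : Op d} (hρ : IsFullRankState ρ) :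
    OrbitAverageLE (fun σ => Real.log ((covariant d).volume σ))
      (fun σ => Real.log (M.volume σ)) ρ := by
  have hvol : ∀ V : U d, Real.log (M.volume (conj V ρ)) = Real.log (unitBallVol d) +
      (Real.log d - Real.log (M.orbitFrame ρ V).det.re) / 2 := by
    intro V
    rw [hM.log_volume (hρ.conj V), Measurement.det_orbitFrame]
  have hcov : ∀ V : U d, Real.log ((covariant d).volume (conj V ρ)) =
      Real.log (unitBallVol d) + (Real.log d - Real.log ((covariant d).frame ρ).det.re) / 2 := by
    intro V
    rw [covariant_isIC.log_volume (hρ.conj V), ← Measurement.det_orbitFrame,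
      covariant_orbitFrame hρ]
  obtain ⟨hint, hle⟩ := hM.integral_log_det_le hρ
  have hi1 : Integrable (fun V : U d => Real.log d - Real.log (M.orbitFrame ρ V).det.re)
      (haarU d) := (integrable_const _).sub hint
  have hi2 := hi1.div_const 2
  refine ⟨?_, ?_, ?_⟩
  · simp only [hcov]
    exact integrable_const _
  · simp only [hvol]
    exact (integrable_const _).add hi2
  · simp only [orbitAverage, hcov, hvol]
    rw [integral_add (integrable_const _) hi2, integral_div,
      integral_sub (integrable_const _) hint]
    simp only [integral_const, probReal_univ, one_smul]
    linarith

/-! ### Weighting matrices -/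

theorem quadForm_smul (O : SuperOp d) (t : ℝ) (X : Op d) :
    quadForm O ((t : ℂ) • X) = t ^ 2 * quadForm O X := by
  simp only [quadForm, vec_smul, Matrix.mulVec_smul, star_smul, smul_dotProduct, dotProduct_smul,
    smul_eq_mul, ← mul_assoc]
  rw [show (t : ℂ) * star (t : ℂ) = ((t ^ 2 : ℝ) : ℂ) by simp [sq], Complex.re_ofReal_mul]

theorem hs_smul (t : ℝ) (X : Op d) :
    (((t : ℂ) • X)ᴴ * ((t : ℂ) • X)).trace.re = t ^ 2 * (Xᴴ * X).trace.re := by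
  rw [Matrix.conjTranspose_smul, Matrix.smul_mul, Matrix.mul_smul, smul_smul, Matrix.trace_smul,
    smul_eq_mul, show star (t : ℂ) * (t : ℂ) = ((t ^ 2 : ℝ) : ℂ) by simp [sq],
    Complex.re_ofReal_mul]

/-- The weighting matrix is determined by the distance, on traceless Hermitian operators. -/
theorem IsWeightOf.tendsto [NeZero d] {W : Op d → SuperOp d} {D : Op d → Op d → ℝ}
    (hW : IsWeightOf W D) {ρ X : Op d} (hρ : IsFullRankState ρ) (hX : X.IsHermitian)
    (htr : X.trace = 0) :
    Filter.Tendsto (fun t : ℝ => D ρ (ρ + (t : ℂ) • X) ^ 2 / t ^ 2) (𝓝[≠] 0)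
      (𝓝 (quadForm (W ρ) X)) := by
  have hc : Continuous fun t : ℝ => ρ + (t : ℂ) • X :=
    continuous_const.add (Complex.continuous_ofReal.smul continuous_const)
  have ht : Filter.Tendsto (fun t : ℝ => ρ + (t : ℂ) • X) (𝓝[≠] 0) (𝓝[{σ | IsState σ}] ρ) := by
    refine tendsto_nhdsWithin_iff.mpr ⟨?_, ?_⟩
    · have := hc.tendsto 0
      simp only [Complex.ofReal_zero, zero_smul, add_zero] at this
      exact this.mono_left nhdsWithin_le_nhds
    · exact (eventually_isState_add_smul hρ hX htr).filter_mono nhdsWithin_le_nhds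
  have h1 := (hW ρ hρ).2.comp_tendsto ht
  simp only [Function.comp_def, add_sub_cancel_left, hs_smul, quadForm_smul] at h1
  have h2 : (fun t : ℝ => D ρ (ρ + (t : ℂ) • X) ^ 2 - t ^ 2 * quadForm (W ρ) X)
      =o[𝓝[≠] 0] fun t : ℝ => t ^ 2 :=
    h1.trans_isBigO (Asymptotics.IsBigO.of_bound |(Xᴴ * X).trace.re|
      (Filter.Eventually.of_forall fun t => by
        rw [norm_mul, mul_comm, Real.norm_eq_abs (Xᴴ * X).trace.re]))
  have h3 := h2.tendsto_div_nhds_zero.add_const (quadForm (W ρ) X)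
  rw [zero_add] at h3
  refine h3.congr' ?_
  filter_upwards [self_mem_nhdsWithin] with t ht0
  have : t ≠ 0 := ht0
  field_simp
  ring

/-- Both sides are limits of the same quotients `D² / t²` along a ray of states. -/
theorem IsWeightOf.quadForm_conj [NeZero d] {W : Op d → SuperOp d} {D : Op d → Op d → ℝ}
    (hW : IsWeightOf W D) (hD : UnitarilyInvariant D) {ρ X : Op d} (hρ : IsFullRankState ρ)
    (hX : X.IsHermitian) (htr : X.trace = 0) (V : U d) :
    quadForm (W (conj V ρ)) (conj V X) = quadForm (W ρ) X := by
  have h1 := hW.tendsto (hρ.conj V) (X := conj V X)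
    (isHermitian_mul_mul_conjTranspose _ hX) (by rw [trace_conj, htr])
  refine tendsto_nhds_unique h1 ((hW.tendsto hρ hX htr).congr' ?_)
  filter_upwards [(eventually_isState_add_smul hρ hX htr).filter_mono nhdsWithin_le_nhds]
    with t ht
  rw [← conj_smul, ← conj_add, hD V _ _ hρ.isState ht]

theorem quadForm_conjSuperOp (S : SuperOp d) (V : U d) (X : Op d) :
    quadForm (conjSuperOp V * S * (conjSuperOp V)ᴴ) X = quadForm S (conj V⁻¹ X) := by
  rw [quadForm, quadForm, ← conjSuperOp_mulVec, ← conjSuperOp_conjTranspose, star_mulVec,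
    conjTranspose_conjTranspose, ← dotProduct_mulVec, Matrix.mulVec_mulVec, Matrix.mulVec_mulVec,
    Matrix.mul_assoc]

namespace Measurement

variable {Ω : Type*} [MeasurableSpace Ω] {M : Measurement d Ω}

/-- `W(V ρ V†)` need not be the conjugate of `W(ρ)`, but the two agree on traceless Hermitian
operators, which is all that the WMSE sees. -/
theorem IsIC.wmse_conj [NeZero d] (hM : M.IsIC) {W : Op d → SuperOp d} {D : Op d → Op d → ℝ}
    (hW : IsWeightOf W D) (hD : UnitarilyInvariant D) {ρ : Op d} (hρ : IsFullRankState ρ)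
    (V : U d) :
    M.wmse W (conj V ρ) =
      (W ρ * (M.orbitFrame ρ V)⁻¹).trace.re - (W ρ * ketBra ρ ρ).trace.re := by
  have h1 := hM.trace_mul_optMSEMatrix_congr (hρ.conj V) (W := W (conj V ρ))
    (W' := conjSuperOp V * W ρ * (conjSuperOp V)ᴴ) (fun X hX htr => by
      have hX' : (conj V⁻¹ X).IsHermitian := isHermitian_mul_mul_conjTranspose _ hX
      rw [quadForm_conjSuperOp, ← hW.quadForm_conj hD hρ hX' (by rw [trace_conj, htr]) V,
        ← conj_mul, mul_inv_cancel, conj_one])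
  have h2 : (conjSuperOp V)ᴴ * ketBra (conj V ρ) (conj V ρ) * conjSuperOp V = ketBra ρ ρ := by
    have := mul_vecMulVec_star_mul (conjSuperOp V)ᴴ (conj V ρ).vec
    rw [conjTranspose_conjTranspose] at this
    rw [ketBra, this, conjSuperOp_conjTranspose, conjSuperOp_mulVec, ← conj_mul, inv_mul_cancel,
      conj_one, ketBra]
  rw [wmse, h1, hM.optMSEMatrix_eq (hρ.conj V), orbitFrame_inv, ← h2, ← Complex.sub_re,
    ← Matrix.trace_sub, ← Matrix.mul_sub, ← Matrix.sub_mul, ← Matrix.mul_sub, Matrix.mul_assoc,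
    Matrix.mul_assoc, Matrix.trace_mul_comm (conjSuperOp V)]
  simp only [Matrix.mul_assoc]

end Measurement

theorem orbitAverageLE_wmse [NeZero d] {Ω : Type*} [MeasurableSpace Ω]
    {M : Measurement d Ω} (hM : M.IsIC) {ρ : Op d} (hρ : IsFullRankState ρ)
    {W : Op d → SuperOp d} {D : Op d → Op d → ℝ} (hD : UnitarilyInvariant D)
    (hW : IsWeightOf W D) : OrbitAverageLE ((covariant d).wmse W) (M.wmse W) ρ := by
  have hint := integrable_haarU (hM.continuous_trace_mul_orbitFrame_inv hρ (W ρ))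
  refine ⟨?_, ?_, ?_⟩
  · simp only [covariant_isIC.wmse_conj hW hD hρ, covariant_orbitFrame hρ]
    exact integrable_const _
  · simp only [hM.wmse_conj hW hD hρ]
    exact hint.sub (integrable_const _)
  · simp only [orbitAverage, covariant_isIC.wmse_conj hW hD hρ, covariant_orbitFrame hρ,
      hM.wmse_conj hW hD hρ]
    rw [integral_sub hint (integrable_const _)]
    simp only [integral_const, probReal_univ, one_smul]
    have := hM.integral_trace_mul_inv_le hρ (hW ρ hρ).1
    linarith

/-! ### The Hilbert-Schmidt distance -/

theorem unitarilyInvariant_hsDist : UnitarilyInvariant (hsDist (d := d)) := by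
  intro V ρ σ _ _
  rw [hsDist, hsDist, ← conj_sub, conj_conjTranspose, conj_mul_conj, trace_conj]

theorem hs_nonneg (X : Op d) : 0 ≤ (Xᴴ * X).trace.re :=
  (Complex.le_def.mp (posSemidef_conjTranspose_mul_self X).trace_nonneg).1

theorem isWeightOf_hsWeight : IsWeightOf hsWeight (hsDist (d := d)) := by
  intro ρ _
  refine ⟨PosSemidef.one, ?_⟩
  have : (fun σ : Op d => hsDist ρ σ ^ 2 - quadForm (hsWeight ρ) (σ - ρ)) = fun _ => 0 := by
    funext σ
    rw [hsDist, Real.sq_sqrt (hs_nonneg _), quadForm, hsWeight, Matrix.one_mulVec,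
      star_vec_dotProduct_vec, ← neg_sub σ ρ, Matrix.conjTranspose_neg, Matrix.neg_mul,
      Matrix.mul_neg, neg_neg, sub_self]
  rw [this]
  exact Asymptotics.isLittleO_zero _ _

/-! ### The Bures distance -/

theorem opSqrt_eq {A : Op d} (hA : A.IsHermitian) :
    opSqrt A = conj hA.eigenvectorUnitary
      (diagonal fun i => (Real.sqrt (hA.eigenvalues i) : ℂ)) := by
  rw [opSqrt, hA.cfc_eq, Matrix.IsHermitian.cfc, Unitary.conjStarAlgAut_apply]
  rfl

theorem posSemidef_opSqrt {A : Op d} (hA : A.PosSemidef) : (opSqrt A).PosSemidef := by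
  rw [opSqrt_eq hA.isHermitian]
  exact posSemidef_conj _ (PosSemidef.diagonal fun i => by simp)

theorem opSqrt_mul_self {A : Op d} (hA : A.PosSemidef) : opSqrt A * opSqrt A = A := by
  rw [opSqrt_eq hA.isHermitian, conj_mul_conj, diagonal_mul_diagonal]
  conv_rhs => rw [spectral_eq hA.isHermitian]
  rw [conj]
  congr 3
  funext i
  rw [← Complex.ofReal_mul, Real.mul_self_sqrt (hA.eigenvalues_nonneg i)]

theorem opSqrt_mul_inv_mul {A : Op d} (hA : A.PosDef) : opSqrt A * A⁻¹ * opSqrt A = 1 := by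
  have hr := opSqrt_mul_self hA.posSemidef
  set r := opSqrt A
  have hru : IsUnit r.det := by
    refine isUnit_iff_ne_zero.mpr fun h0 => hA.det_pos.ne' ?_
    rw [← hr, det_mul, h0, mul_zero]
  rw [← hr, Matrix.mul_inv_rev, ← Matrix.mul_assoc, Matrix.mul_nonsing_inv _ hru,
    Matrix.one_mul, Matrix.nonsing_inv_mul _ hru]

theorem opSqrt_conj {A : Op d} (hA : A.IsHermitian) (V : U d) :
    opSqrt (conj V A) = conj V (opSqrt A) := by
  have hc : Continuous (Unitary.conjStarAlgAut ℂ (Op d) V) := by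
    have : ⇑(Unitary.conjStarAlgAut ℂ (Op d) V) = fun A : Op d => conj V A := rfl
    rw [this]
    exact (continuous_const.matrix_mul continuous_id).matrix_mul continuous_const
  exact (StarAlgHomClass.map_cfc (S := ℂ) (Unitary.conjStarAlgAut ℂ (Op d) V) Real.sqrt A
    (Real.continuous_sqrt.continuousOn) hc hA.isSelfAdjoint
    (isHermitian_mul_mul_conjTranspose _ hA).isSelfAdjoint).symm

theorem unitarilyInvariant_buresDist : UnitarilyInvariant (buresDist (d := d)) := by
  intro V ρ σ hρ hσ
  have hr := posSemidef_opSqrt hρ.1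
  have h1 : (opSqrt ρ * σ * opSqrt ρ).IsHermitian := by
    have := isHermitian_mul_mul_conjTranspose (opSqrt ρ) hσ.1.isHermitian
    rwa [hr.isHermitian.eq] at this
  rw [buresDist, buresDist, opSqrt_conj hρ.1.isHermitian, conj_mul_conj, conj_mul_conj,
    opSqrt_conj h1, trace_conj]

/-- The Hilbert-Schmidt norm. -/
def hsNorm (A : Op d) : ℝ := Real.sqrt (Aᴴ * A).trace.re

theorem hsNorm_nonneg (A : Op d) : 0 ≤ hsNorm A := Real.sqrt_nonneg _

theorem hsNorm_sq (A : Op d) : hsNorm A ^ 2 = (Aᴴ * A).trace.re := Real.sq_sqrt (hs_nonneg A)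

theorem hsNorm_neg (A : Op d) : hsNorm (-A) = hsNorm A := by simp [hsNorm]

theorem hs_eq_sum (A : Op d) : (Aᴴ * A).trace.re = ∑ i, ∑ j, ‖A i j‖ ^ 2 := by
  simp only [Matrix.trace, Matrix.diag, Matrix.mul_apply, Complex.re_sum,
    Matrix.conjTranspose_apply]
  rw [Finset.sum_comm]
  refine Finset.sum_congr rfl fun i _ => Finset.sum_congr rfl fun j _ => ?_
  have := Complex.conj_mul' (A i j)
  rw [starRingEnd_apply] at this
  rw [this, ← Complex.ofReal_pow, Complex.ofReal_re]

open scoped Matrix.Norms.Frobenius in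
theorem norm_eq_hsNorm (A : Op d) : ‖A‖ = hsNorm A := by
  rw [frobenius_norm_def, hsNorm, hs_eq_sum, Real.sqrt_eq_rpow]
  simp

theorem hsNorm_mul_le (A B : Op d) : hsNorm (A * B) ≤ hsNorm A * hsNorm B := by
  rw [← norm_eq_hsNorm, ← norm_eq_hsNorm, ← norm_eq_hsNorm]
  exact frobenius_norm_mul A B

theorem abs_trace_re_le (A : Op d) : |A.trace.re| ≤ d * hsNorm A := by
  have h : ∀ i, ‖A i i‖ ≤ hsNorm A := by
    intro i
    refine Real.le_sqrt_of_sq_le ?_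
    rw [hs_eq_sum]
    refine (Finset.single_le_sum (f := fun j => ‖A i j‖ ^ 2) (fun j _ => by positivity)
      (Finset.mem_univ i)).trans ?_
    exact Finset.single_le_sum (f := fun i => ∑ j, ‖A i j‖ ^ 2)
      (fun j _ => Finset.sum_nonneg fun _ _ => by positivity) (Finset.mem_univ i)
  calc |A.trace.re| ≤ ‖A.trace‖ := Complex.abs_re_le_norm _
    _ ≤ ∑ i, ‖A i i‖ := norm_sum_le _ _
    _ ≤ ∑ _i : Fin d, hsNorm A := Finset.sum_le_sum fun i _ => h i
    _ = d * hsNorm A := by simp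

/-- An a priori bound for the solution `Y` of the Sylvester equation `S Y + Y T = E`. -/
theorem hsNorm_le_of_sylvester {S T Y E : Op d} {c : ℝ} (hc : 0 < c) (hS : S.PosSemidef)
    (hT : (T - (c : ℂ) • (1 : Op d)).PosSemidef) (h : S * Y + Y * T = E) :
    hsNorm Y ≤ c⁻¹ * hsNorm E := by
  -- Pair the equation with `Y`: the `S` term is nonnegative and the `T` term at least `c ‖Y‖²`.
  have h1 : c * (Yᴴ * Y).trace.re ≤ (Yᴴ * E).trace.re := by
    have a1 := (Complex.le_def.mp (hS.conjTranspose_mul_mul_same Y).trace_nonneg).1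
    have a2 := (Complex.le_def.mp (trace_mul_nonneg (posSemidef_conjTranspose_mul_self Y) hT)).1
    rw [Matrix.mul_sub, Matrix.mul_smul, Matrix.mul_one, Matrix.trace_sub, Matrix.trace_smul,
      smul_eq_mul, Complex.sub_re, Complex.re_ofReal_mul] at a2
    rw [← h, Matrix.mul_add, ← Matrix.mul_assoc, ← Matrix.mul_assoc, Matrix.trace_add,
      Complex.add_re]
    simp only [Complex.zero_re] at a1 a2
    linarith
  have h2 : (Eᴴ * Y).trace.re = (Yᴴ * E).trace.re := by
    rw [← Complex.conj_re, starRingEnd_apply, ← Matrix.trace_conjTranspose,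
      Matrix.conjTranspose_mul, conjTranspose_conjTranspose]
  -- Expanding `‖c Y - E‖² ≥ 0` does the work of Cauchy-Schwarz.
  have h3 := hs_nonneg ((c : ℂ) • Y - E)
  rw [Matrix.conjTranspose_sub, Matrix.conjTranspose_smul, Matrix.mul_sub, Matrix.sub_mul,
    Matrix.sub_mul, Matrix.smul_mul, Matrix.smul_mul, Matrix.mul_smul, Matrix.mul_smul] at h3
  simp only [Matrix.trace_sub, Matrix.trace_smul, smul_eq_mul, Complex.sub_re,
    Complex.re_ofReal_mul, Complex.star_def, Complex.conj_ofReal, h2] at h3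
  have h4 : (c * hsNorm Y) ^ 2 ≤ hsNorm E ^ 2 := by
    rw [mul_pow, hsNorm_sq, hsNorm_sq]
    nlinarith
  rw [le_inv_mul_iff₀ hc]
  exact (sq_le_sq₀ (mul_nonneg hc.le (hsNorm_nonneg _)) (hsNorm_nonneg _)).mp h4

/-- The superoperator `X ↦ ρ X + X ρ`. -/
def anticommSuperOp (ρ : Op d) : SuperOp d := (1 : Op d) ⊗ₖ ρ + ρᵀ ⊗ₖ (1 : Op d)

theorem anticommSuperOp_mulVec (ρ Z : Op d) :
    anticommSuperOp ρ *ᵥ Z.vec = (ρ * Z + Z * ρ).vec := by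
  rw [anticommSuperOp, Matrix.add_mulVec, kronecker_mulVec_vec, kronecker_mulVec_vec, ← vec_add]
  simp

theorem posDef_anticommSuperOp {ρ : Op d} (hρ : ρ.PosDef) : (anticommSuperOp ρ).PosDef :=
  (PosDef.one.kronecker hρ).add (hρ.transpose.kronecker PosDef.one)

theorem posSemidef_buresWeight {ρ : Op d} (hρ : ρ.PosDef) : (buresWeight ρ).PosSemidef := by
  have h : (0 : ℂ) ≤ 1 / 2 := by
    rw [Complex.le_def]
    norm_num
  exact (posDef_anticommSuperOp hρ).inv.posSemidef.smul h

/-- The weight sends `X` to `Z / 2`, and `tr(X Z) = 2 tr(Z ρ Z)` by cyclicity. -/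
theorem quadForm_buresWeight {ρ : Op d} (hρ : ρ.PosDef) {X Z : Op d} (hX : X.IsHermitian)
    (hZ : ρ * Z + Z * ρ = X) : quadForm (buresWeight ρ) X = (Z * ρ * Z).trace.re := by
  have hu := (Matrix.isUnit_iff_isUnit_det _).mp (posDef_anticommSuperOp hρ).isUnit
  have h1 : (anticommSuperOp ρ)⁻¹ *ᵥ X.vec = Z.vec := by
    rw [← hZ, ← anticommSuperOp_mulVec, Matrix.mulVec_mulVec, Matrix.nonsing_inv_mul _ hu,
      Matrix.one_mulVec]
  have h2 : buresWeight ρ = (1 / 2 : ℂ) • (anticommSuperOp ρ)⁻¹ := rfl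
  rw [quadForm, h2, Matrix.smul_mulVec, h1, dotProduct_smul, star_vec_dotProduct_vec, hX.eq,
    ← hZ, Matrix.add_mul, Matrix.trace_add, Matrix.mul_assoc ρ Z Z, Matrix.trace_mul_comm ρ,
    Matrix.mul_assoc Z Z ρ, Matrix.trace_mul_comm Z (Z * ρ)]
  congr 1
  rw [smul_eq_mul]
  ring

/-- The squared Bures distance in terms of the deviation `√(√ρ σ √ρ) - ρ`. -/
theorem buresDist_sq {ρ σ : Op d} (hρ : IsFullRankState ρ) (hσ : IsState σ) :
    buresDist ρ σ ^ 2 = (ρ⁻¹ * ((opSqrt (opSqrt ρ * σ * opSqrt ρ) - ρ) *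
      (opSqrt (opSqrt ρ * σ * opSqrt ρ) - ρ))).trace.re := by
  have hu := (Matrix.isUnit_iff_isUnit_det _).mp hρ.1.isUnit
  have hrH := posSemidef_opSqrt hρ.1.posSemidef
  set r := opSqrt ρ
  have hA : (r * σ * r).PosSemidef := by
    have := hσ.1.mul_mul_conjTranspose_same r
    rwa [hrH.isHermitian.eq] at this
  have hS := posSemidef_opSqrt hA
  have hSS := opSqrt_mul_self hA
  set S := opSqrt (r * σ * r)
  have hrr : r * ρ⁻¹ * r = 1 := opSqrt_mul_inv_mul hρ.1
  have h1 : (ρ⁻¹ * ((S - ρ) * (S - ρ))).trace = 2 - 2 * S.trace := by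
    have e1 : (S - ρ) * (S - ρ) = r * σ * r - S * ρ - ρ * S + ρ * ρ := by
      rw [← hSS, Matrix.sub_mul, Matrix.mul_sub, Matrix.mul_sub]
      abel
    have e2 : (ρ⁻¹ * (r * σ * r)).trace = 1 := by
      rw [← Matrix.mul_assoc, Matrix.trace_mul_comm, ← Matrix.mul_assoc, ← Matrix.mul_assoc, hrr,
        Matrix.one_mul, hσ.2]
    have e3 : (ρ⁻¹ * (S * ρ)).trace = S.trace := by
      rw [Matrix.trace_mul_comm, Matrix.mul_assoc, Matrix.mul_nonsing_inv _ hu, Matrix.mul_one]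
    have e4 : ρ⁻¹ * (ρ * S) = S := by
      rw [← Matrix.mul_assoc, Matrix.nonsing_inv_mul _ hu, Matrix.one_mul]
    have e5 : ρ⁻¹ * (ρ * ρ) = ρ := by
      rw [← Matrix.mul_assoc, Matrix.nonsing_inv_mul _ hu, Matrix.one_mul]
    rw [e1, Matrix.mul_add, Matrix.mul_sub, Matrix.mul_sub, Matrix.trace_add, Matrix.trace_sub,
      Matrix.trace_sub, e2, e3, e4, e5, hρ.2]
    ring
  -- Nonnegativity of the radicand lets the square undo the real square root in `buresDist`.
  have h2 : 0 ≤ (ρ⁻¹ * ((S - ρ) * (S - ρ))).trace.re := by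
    have hY : (S - ρ)ᴴ = S - ρ := (hS.isHermitian.sub hρ.1.isHermitian).eq
    have := trace_mul_nonneg hρ.1.inv.posSemidef (posSemidef_conjTranspose_mul_self (S - ρ))
    rw [hY] at this
    exact (Complex.le_def.mp this).1
  rw [h1] at h2 ⊢
  have h3 : ((2 : ℂ) - 2 * S.trace).re = 2 - 2 * S.trace.re := by simp
  rw [h3] at h2 ⊢
  exact Real.sq_sqrt h2

/-- The deviation `Y` of `√(√ρ σ √ρ)` from `ρ` is compared with its linearization `Y₁ = √ρ Z √ρ`.
Both are `O(‖X‖)` and differ by `O(‖X‖²)`, and the two quantities compared are `tr(ρ⁻¹ Y²)` and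
`tr(ρ⁻¹ Y₁²)`. -/
theorem exists_buresDist_sq_sub_le [NeZero d] {ρ : Op d} (hρ : IsFullRankState ρ) :
    ∃ K : ℝ, 0 ≤ K ∧ ∀ σ, IsState σ →
      |buresDist ρ σ ^ 2 - quadForm (buresWeight ρ) (σ - ρ)| ≤ K * hsNorm (σ - ρ) ^ 3 := by
  obtain ⟨c, hc, hρc⟩ := PosDef.exists_sub_smul_one hρ.1
  have hL := (Matrix.isUnit_iff_isUnit_det _).mp (posDef_anticommSuperOp hρ.1).isUnit
  set k := c⁻¹ * (hsNorm (opSqrt ρ) * hsNorm (opSqrt ρ)) with hk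
  have hk0 : 0 ≤ k := by
    have := hsNorm_nonneg (opSqrt ρ)
    positivity
  have hn0 := hsNorm_nonneg ρ⁻¹
  -- The two error terms each pair a factor bounded by `k ‖X‖` with one bounded by `c⁻¹ k² ‖X‖²`;
  -- `d` comes from `abs_trace_re_le`.
  refine ⟨d * (hsNorm ρ⁻¹ * (c⁻¹ * k ^ 2 * (2 * k))), by positivity, fun σ hσ => ?_⟩
  set X := σ - ρ with hXdef
  have hX : X.IsHermitian := hσ.1.isHermitian.sub hρ.1.isHermitian
  obtain ⟨Z, hZv⟩ := vec_bijective.surjective ((anticommSuperOp ρ)⁻¹ *ᵥ X.vec)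
  have hZ : ρ * Z + Z * ρ = X := by
    rw [← vec_inj, ← anticommSuperOp_mulVec, hZv, Matrix.mulVec_mulVec,
      Matrix.mul_nonsing_inv _ hL, Matrix.one_mulVec]
  rw [quadForm_buresWeight hρ.1 hX hZ, buresDist_sq hρ hσ]
  have hrH := posSemidef_opSqrt hρ.1.posSemidef
  have hr := opSqrt_mul_self hρ.1.posSemidef
  set r := opSqrt ρ
  have hA : (r * σ * r).PosSemidef := by
    have := hσ.1.mul_mul_conjTranspose_same r
    rwa [hrH.isHermitian.eq] at this
  have hS := posSemidef_opSqrt hA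
  have hSS := opSqrt_mul_self hA
  set S := opSqrt (r * σ * r)
  set Y := S - ρ with hY
  set Y₁ := r * Z * r with hY₁
  have hrr : r * ρ⁻¹ * r = 1 := opSqrt_mul_inv_mul hρ.1
  have hq : (Z * ρ * Z).trace = (ρ⁻¹ * (Y₁ * Y₁)).trace := by
    have : ρ⁻¹ * (Y₁ * Y₁) = ρ⁻¹ * r * (Z * ρ * Z) * r := by
      rw [hY₁, ← hr]
      simp only [Matrix.mul_assoc]
    rw [this, Matrix.trace_mul_comm _ r, ← Matrix.mul_assoc r, ← Matrix.mul_assoc r, hrr,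
      Matrix.one_mul]
  -- This is `S² - ρ²` factored as `S (S - ρ) + (S - ρ) ρ`.
  have hE : S * Y + Y * ρ = r * X * r := by
    rw [hY, hXdef, Matrix.mul_sub, Matrix.sub_mul, hSS, Matrix.mul_sub, Matrix.sub_mul, ← hr]
    simp only [Matrix.mul_assoc]
    abel
  have hE₁ : ρ * Y₁ + Y₁ * ρ = r * X * r := by
    rw [hY₁, ← hZ, ← hr]
    simp only [Matrix.mul_assoc, Matrix.mul_add, Matrix.add_mul]
  -- Substituting `S = ρ + Y` leaves the quadratic remainder `-Y²` as the only source.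
  have hR : ρ * (Y - Y₁) + (Y - Y₁) * ρ = -(Y * Y) := by
    have h1 : Y * Y = S * Y - ρ * Y := by
      conv_lhs =>
        enter [1]
        rw [hY]
      rw [Matrix.sub_mul]
    rw [h1, Matrix.mul_sub, Matrix.sub_mul]
    have := hE.trans hE₁.symm
    rw [eq_sub_of_add_eq this]
    abel
  have hEn : hsNorm (r * X * r) ≤ hsNorm r * hsNorm r * hsNorm X := by
    refine (hsNorm_mul_le _ _).trans ?_
    calc hsNorm (r * X) * hsNorm r ≤ hsNorm r * hsNorm X * hsNorm r := by
          gcongr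
          · exact hsNorm_nonneg _
          · exact hsNorm_mul_le _ _
      _ = _ := by ring
  have hcEn : c⁻¹ * hsNorm (r * X * r) ≤ k * hsNorm X := by
    rw [hk, mul_assoc c⁻¹]
    exact mul_le_mul_of_nonneg_left hEn (inv_nonneg.mpr hc.le)
  have nY : hsNorm Y ≤ k * hsNorm X := (hsNorm_le_of_sylvester hc hS hρc hE).trans hcEn
  have nY₁ : hsNorm Y₁ ≤ k * hsNorm X :=
    (hsNorm_le_of_sylvester hc hρ.1.posSemidef hρc hE₁).trans hcEn
  have hX0 := hsNorm_nonneg X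
  have nR : hsNorm (Y - Y₁) ≤ c⁻¹ * ((k * hsNorm X) * (k * hsNorm X)) := by
    refine (hsNorm_le_of_sylvester hc hρ.1.posSemidef hρc hR).trans ?_
    rw [hsNorm_neg]
    gcongr
    refine (hsNorm_mul_le _ _).trans ?_
    exact mul_le_mul nY nY (hsNorm_nonneg _) (by positivity)
  have hdiff : (ρ⁻¹ * (Y * Y)).trace.re - (ρ⁻¹ * (Y₁ * Y₁)).trace.re =
      (ρ⁻¹ * (Y * (Y - Y₁))).trace.re + (ρ⁻¹ * ((Y - Y₁) * Y₁)).trace.re := by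
    rw [← Complex.sub_re, ← Complex.add_re, ← Matrix.trace_sub, ← Matrix.trace_add,
      ← Matrix.mul_sub, ← Matrix.mul_add]
    congr 3
    rw [Matrix.mul_sub Y Y Y₁, Matrix.sub_mul Y Y₁ Y₁]
    abel
  have hbound : ∀ P Q : Op d, ∀ p q : ℝ, 0 ≤ p → hsNorm P ≤ p → hsNorm Q ≤ q →
      |(ρ⁻¹ * (P * Q)).trace.re| ≤ d * (hsNorm ρ⁻¹ * (p * q)) := by
    intro P Q p q hp hP hQ
    refine (abs_trace_re_le _).trans ?_
    gcongr
    refine (hsNorm_mul_le _ _).trans ?_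
    gcongr
    exact (hsNorm_mul_le _ _).trans (mul_le_mul hP hQ (hsNorm_nonneg _) hp)
  rw [hq, hdiff]
  refine (abs_add_le _ _).trans ?_
  have b1 := hbound Y (Y - Y₁) _ _ (by positivity) nY nR
  have b2 := hbound (Y - Y₁) Y₁ _ _ (by positivity) nR nY₁
  refine (add_le_add b1 b2).trans (le_of_eq ?_)
  ring

theorem isWeightOf_buresWeight [NeZero d] : IsWeightOf buresWeight (buresDist (d := d)) := by
  intro ρ hρ
  refine ⟨posSemidef_buresWeight hρ.1, ?_⟩
  obtain ⟨K, hK, h⟩ := exists_buresDist_sq_sub_le hρ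
  have h1 : (fun σ : Op d => buresDist ρ σ ^ 2 - quadForm (buresWeight ρ) (σ - ρ))
      =O[𝓝[{σ | IsState σ}] ρ] fun σ => hsNorm (σ - ρ) * ((σ - ρ)ᴴ * (σ - ρ)).trace.re := by
    refine Asymptotics.IsBigO.of_bound K ?_
    filter_upwards [self_mem_nhdsWithin] with σ hσ
    have h0 := hsNorm_nonneg (σ - ρ)
    rw [Real.norm_eq_abs, Real.norm_eq_abs, ← hsNorm_sq,
      abs_of_nonneg (a := hsNorm (σ - ρ) * hsNorm (σ - ρ) ^ 2) (by positivity)]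
    refine (h σ hσ).trans (le_of_eq ?_)
    ring
  refine h1.trans_isLittleO ?_
  have hc : Continuous fun σ : Op d => hsNorm (σ - ρ) := by
    have hs : Continuous fun σ : Op d => σ - ρ := continuous_id.sub continuous_const
    exact Real.continuous_sqrt.comp (Complex.continuous_re.comp
      (hs.matrix_conjTranspose.matrix_mul hs).matrix_trace)
  have h2 : Filter.Tendsto (fun σ : Op d => hsNorm (σ - ρ)) (𝓝[{σ | IsState σ}] ρ) (𝓝 0) := by
    have := hc.tendsto ρ
    simp only [sub_self] at this
    rw [show hsNorm (0 : Op d) = 0 by simp [hsNorm]] at this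
    exact this.mono_left nhdsWithin_le_nhds
  have h3 := ((Asymptotics.isLittleO_one_iff ℝ).mpr h2).mul_isBigO
    (Asymptotics.isBigO_refl (fun σ : Op d => ((σ - ρ)ᴴ * (σ - ρ)).trace.re)
      (𝓝[{σ | IsState σ}] ρ))
  simpa using h3

end QTomo

end

theorem mainTheorem4 {d : ℕ} [NeZero d] {Ω : Type*} [MeasurableSpace Ω]
    (M : QTomo.Measurement d Ω) (hM : M.IsIC) (ρ : QTomo.Op d) (hρ : QTomo.IsFullRankState ρ) :
    -- the covariant measurement is itself one of the measurements in question
    (QTomo.covariant d).IsIC ∧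
    -- it minimizes the average WMSE based on any unitarily invariant distance
    (∀ (D : QTomo.Op d → QTomo.Op d → ℝ) (W : QTomo.Op d → QTomo.SuperOp d),
      QTomo.UnitarilyInvariant D → QTomo.IsWeightOf W D →
      QTomo.OrbitAverageLE ((QTomo.covariant d).wmse W) (M.wmse W) ρ) ∧
    -- the MSE (Hilbert-Schmidt distance)
    (QTomo.UnitarilyInvariant (QTomo.hsDist (d := d)) ∧
      QTomo.IsWeightOf QTomo.hsWeight (QTomo.hsDist (d := d)) ∧
      QTomo.OrbitAverageLE ((QTomo.covariant d).wmse QTomo.hsWeight) (M.wmse QTomo.hsWeight) ρ) ∧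
    -- the MSB (Bures distance)
    (QTomo.UnitarilyInvariant (QTomo.buresDist (d := d)) ∧
      QTomo.IsWeightOf QTomo.buresWeight (QTomo.buresDist (d := d)) ∧
      QTomo.OrbitAverageLE ((QTomo.covariant d).wmse QTomo.buresWeight)
        (M.wmse QTomo.buresWeight) ρ) ∧
    -- the average log-volume of the uncertainty ellipsoid
    QTomo.OrbitAverageLE (fun σ => Real.log ((QTomo.covariant d).volume σ))
      (fun σ => Real.log (M.volume σ)) ρ := by
  have hHS := QTomo.orbitAverageLE_wmse hM hρ QTomo.unitarilyInvariant_hsDist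
    QTomo.isWeightOf_hsWeight
  have hB := QTomo.orbitAverageLE_wmse hM hρ QTomo.unitarilyInvariant_buresDist
    QTomo.isWeightOf_buresWeight
  exact ⟨QTomo.covariant_isIC, fun D W hD hW => QTomo.orbitAverageLE_wmse hM hρ hD hW,
    ⟨QTomo.unitarilyInvariant_hsDist, QTomo.isWeightOf_hsWeight, hHS⟩,
    ⟨QTomo.unitarilyInvariant_buresDist, QTomo.isWeightOf_buresWeight, hB⟩,
    QTomo.orbitAverageLE_log_volume hM hρ⟩
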